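/- Let $p\in(1,\infty)$ and let $G\in C^\infty(\mathbb R)$ be odd with $\dot G>0$ and $\int_{\mathbb R}|s|\dot G(s)\,ds<\infty$. An obstacle is a function $\psi\in C^0([0,1])$ with $\psi(0),\psi(1)<0$ and $\psi(x_0)>0$ for some $x_0\in(0,1)$; put $$M(\psi)=\{v\in W^{2,p}(0,1)\cap W^{1,p}_0(0,1) : v\ge\psi \text{ in } [0,1]\}$$ (elements are identified with their continuous representatives on $[0,1]$). For $u\in M(\psi)$ let $$w_u=-p\,\dot G(u')^{p-1}|u''|^{p-2}u''.$$ Call $u\in M(\psi)$ a critical point of $\mathcal E(u)=\int_0^1|G(u')'|^p\,dx$ with obstacle constraint if there is a (positive) Radon measure $\mu$ supported on $\{u=\psi\}$ such that $$-\int_0^1 w_u\,\frac{d}{dx}\bigl(\dot G(u')\phi'\bigr)\,dx=\int_0^1\phi\,d\mu\qquad\text{for all }\phi\in W^{2,p}(0,1)\cap W^{1,p}_0(0,1).$$ **Theorem.** Let $\psi$ be an obstacle and $u\in M(\psi)$ a critical point. Then $u\in C^2([0,1])$, $u''(x)<0$ for all $x\in(0,1)$, and $u''(0)=u''(1)=0$;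 in particular, $u$ is concave. Moreover: (i) If $1<p\le2$, then $u\in W^{3,\infty}(0,1)$ and $u'''\in BV(0,1)$, but in general $u\notin C^3(0,1)$: if $\psi$ is a cone obstacle, that is, if for some $\theta\in(0,1)$ the restrictions $\psi|_{[0,\theta]}$ and $\psi|_{[\theta,1]}$ are affine, then no critical point in $M(\psi)$ belongs to $C^3(0,1)$; and for every such $p$ and $G$ there is a cone obstacle $\psi$ for which $M(\psi)$ contains a critical point. (ii) If $p>2$, then $u\in W^{3,q}(0,1)$ for all $q\in\bigl[1,\tfrac{p-1}{p-2}\bigr)$, but $u\notin W^{3,\frac{p-1}{p-2}}(0,1)$. -/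

import Mathlib

open MeasureTheory Set
open scoped ContDiff ENNReal

namespace ObstacleProblem

noncomputable section

/-- Test functions: `φ ∈ C_c^∞(0,1)`, extended by zero to `ℝ`. -/
structure IsTestFun (φ : ℝ → ℝ) : Prop where
  smooth : ContDiff ℝ ∞ φ
  compact : HasCompactSupport φ
  support : tsupport φ ⊆ Ioo 0 1

/-- `g` is a weak derivative of `f` on the interval `(0,1)`. -/
structure HasWeakDeriv (f g : ℝ → ℝ) : Prop where
  locInt : LocallyIntegrableOn f (Ioo 0 1)
  locInt_deriv : LocallyIntegrableOn g (Ioo 0 1)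
  parts : ∀ φ, IsTestFun φ →
    ∫ x in Ioo (0 : ℝ) 1, f x * deriv φ x = -∫ x in Ioo (0 : ℝ) 1, g x * φ x

open Classical in
/-- The weak derivative of `f` on `(0,1)` (determined up to a null set) if there is one, and `0`
otherwise. -/
def weakDeriv (f : ℝ → ℝ) : ℝ → ℝ :=
  if h : ∃ g, HasWeakDeriv f g then h.choose else 0

/-- `f ∈ W^{k,q}(0,1)`: `f` and its weak derivatives up to order `k` lie in `L^q(0,1)`. -/
def MemSobolev : ℕ → ℝ≥0∞ → (ℝ → ℝ) → Prop
  | 0, q, f => MemLp f q (volume.restrict (Ioo 0 1))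
  | k + 1, q, f => MemLp f q (volume.restrict (Ioo 0 1)) ∧
      ∃ g, HasWeakDeriv f g ∧ MemSobolev k q g

/-- `f` is the continuous representative on `[0,1]` of an element of
`W^{2,p}(0,1) ∩ W^{1,p}_0(0,1)`. In one dimension `W^{1,p}_0(0,1)` consists of the elements of
`W^{1,p}(0,1)` with zero trace, i.e. with continuous representative vanishing at `0` and `1`. The
values of `f` outside `[0,1]` are irrelevant. -/
structure MemNavier (p : ℝ) (f : ℝ → ℝ) : Prop where
  sobolev : MemSobolev 2 (ENNReal.ofReal p) f
  cont : ContinuousOn f (Icc 0 1)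
  left : f 0 = 0
  right : f 1 = 0

/-- `f ∈ BV(0,1)`: `f ∈ L^1(0,1)` and the total variation
`sup {∫ f φ' : φ ∈ C_c^∞(0,1), |φ| ≤ 1}` is finite. -/
def MemBV (f : ℝ → ℝ) : Prop :=
  IntegrableOn f (Ioo 0 1) ∧
    ∃ M : ℝ, ∀ φ, IsTestFun φ → (∀ x, |φ x| ≤ 1) → ∫ x in Ioo (0 : ℝ) 1, f x * deriv φ x ≤ M

/-- The standing assumption on the obstacle `ψ : [0,1] → ℝ`. -/
structure IsObstacle (ψ : ℝ → ℝ) : Prop where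
  cont : ContinuousOn ψ (Icc 0 1)
  left : ψ 0 < 0
  right : ψ 1 < 0
  pos : ∃ x ∈ Ioo (0 : ℝ) 1, 0 < ψ x

/-- Cone obstacles: affine on `[0,θ]` and on `[θ,1]` for some `θ ∈ (0,1)`. -/
def IsCone (ψ : ℝ → ℝ) : Prop :=
  ∃ θ ∈ Ioo (0 : ℝ) 1, ∃ a b c d : ℝ,
    (∀ x ∈ Icc 0 θ, ψ x = a * x + b) ∧ ∀ x ∈ Icc θ 1, ψ x = c * x + d

/-- The standing assumption on the function `G` of the functional `u ↦ ∫₀¹ |G(u')'|^p dx`. -/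
structure IsAdmissible (G : ℝ → ℝ) : Prop where
  smooth : ContDiff ℝ ∞ G
  odd : ∀ s, G (-s) = -G s
  deriv_pos : ∀ s, 0 < deriv G s
  integrable : Integrable (fun s => s * deriv G s)

/-- The admissible set `M(ψ)`. -/
structure MemM (p : ℝ) (ψ u : ℝ → ℝ) : Prop where
  navier : MemNavier p u
  above : ∀ x ∈ Icc (0 : ℝ) 1, ψ x ≤ u x

/-- Euler's substitution `w_u = -p G'(u')^{p-1} |u''|^{p-2} u''`. The last two factors have the
value `0` where `u'' = 0`, also for `p ≤ 2`. -/
def eulerSubst (p : ℝ) (G u : ℝ → ℝ) (x : ℝ) : ℝ :=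
  -p * deriv G (weakDeriv u x) ^ (p - 1) *
    (|weakDeriv (weakDeriv u) x| ^ (p - 2) * weakDeriv (weakDeriv u) x)

/-- The coincidence set `{u = ψ}`. -/
def coincidenceSet (ψ u : ℝ → ℝ) : Set ℝ := {x ∈ Icc (0 : ℝ) 1 | u x = ψ x}

/-- `u ∈ M(ψ)` is a critical point with obstacle constraint: there is a (positive) Radon measure
`μ` supported on `{u = ψ}` for which the measure-valued Euler–Lagrange equation holds. -/
structure IsCriticalPoint (p : ℝ) (G ψ u : ℝ → ℝ) : Prop where
  mem : MemM p ψ u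
  eulerLagrange : ∃ μ : Measure ℝ, IsLocallyFiniteMeasure μ ∧ μ (coincidenceSet ψ u)ᶜ = 0 ∧
    ∀ φ, MemNavier p φ →
      -∫ x in Ioo (0 : ℝ) 1, eulerSubst p G u x *
          weakDeriv (fun y => deriv G (weakDeriv u y) * weakDeriv φ y) x
        = ∫ x in Icc (0 : ℝ) 1, φ x ∂μ

end

end ObstacleProblem

open ObstacleProblem

/-! Write v = u', g = G'(v), and let m(y) = μ([y,1]) be the tail of the contact measure. Testing
with φ such that gφ' = η is prescribed, and using ∫ φ dμ = ∫ φ'm, turns the Euler–Lagrange equation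
into g·w_u' = m - c for a constant c, with the natural boundary conditions w_u(0) = w_u(1) = 0.
Hence w_u = W, where W(x) = ∫₀ˣ (m - c)/g is the `flux` (`euler_eq_flux`).

Since ψ is negative at 0 and 1, the contact set stays away from both ends, so m is a constant M near
0 and vanishes near 1. Here M > 0, because M = 0 would give u = 0, which lies below ψ somewhere. As
m is nonincreasing and W vanishes at both ends, 0 < c < M and W ≥ k·x(1-x) with k > 0
(`flux_lower_bound`). Solving the definition of w_u for u'' gives u'' = -(W/p)^(1/(p-1))/g
(`IsCriticalPoint.exists_profile`); continuity of u'', its sign and its boundary values follow at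
once.

Differentiating once more, u''' is W^(1/(p-1)-1) times a bounded factor containing m, plus a
continuous term. For p ≤ 2 the exponent is nonnegative, so u''' is bounded, and it is BV because m
is monotone. For p > 2 the power is singular at the ends, and the linear lower bound on W makes its
q-th power integrable for q < (p-1)/(p-2). At the limiting exponent Hölder's inequality would give
u''(x) = o(x^(1/(p-1))) at 0, against the lower bound on W (`CriticalProfile.not_memSobolev_three`).

Over a cone, strict concavity leaves only the vertex as contact point, so μ is a point mass, m jumps
there, and W has a corner at a point where W > 0; this excludes C³
(`CriticalProfile.not_contDiffOn_three_of_isCone`). A critical point is found explicitly by using a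
multiple of W as the parameter on the left half of a symmetric profile: u' is then an elementary
function of the parameter and x is a quadrature (`exists_symmetric_profile`). -/

open Filter Topology

/-! ### Absolutely continuous functions on an interval. -/

namespace AbsolutelyContinuousOnInterval

theorem congr_eqOn {f g : ℝ → ℝ} {a b : ℝ} (hf : AbsolutelyContinuousOnInterval f a b)
    (h : EqOn f g (uIcc a b)) : AbsolutelyContinuousOnInterval g a b := by
  rw [absolutelyContinuousOnInterval_iff] at hf ⊢
  intro ε hε
  obtain ⟨δ, hδ, H⟩ := hf ε hε
  refine ⟨δ, hδ, fun E hE hE' => ?_⟩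
  have := H E hE hE'
  refine lt_of_eq_of_lt (Finset.sum_congr rfl fun i hi => ?_) this
  have h1 := hE.1 i hi
  rw [h h1.1, h h1.2]

theorem lipschitzOnWith_comp {f H : ℝ → ℝ} {a b : ℝ} {s : Set ℝ} {K : NNReal}
    (hf : AbsolutelyContinuousOnInterval f a b) (hH : LipschitzOnWith K H s)
    (hs : MapsTo f (uIcc a b) s) : AbsolutelyContinuousOnInterval (fun x => H (f x)) a b := by
  rw [absolutelyContinuousOnInterval_iff] at hf ⊢
  intro ε hε
  obtain ⟨δ, hδ, h⟩ := hf (ε / (K + 1)) (by positivity)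
  refine ⟨δ, hδ, fun E hE hE' => ?_⟩
  have h0 := h E hE hE'
  calc _ ≤ ∑ i ∈ Finset.range E.1, (K : ℝ) * dist (f (E.2 i).1) (f (E.2 i).2) := by
        refine Finset.sum_le_sum fun i hi => ?_
        have h1 := hE.1 i hi
        exact hH.dist_le_mul _ (hs h1.1) _ (hs h1.2)
    _ = K * ∑ i ∈ Finset.range E.1, dist (f (E.2 i).1) (f (E.2 i).2) := by
        rw [Finset.mul_sum]
    _ ≤ K * (ε / (K + 1)) := by gcongr
    _ < (K + 1) * (ε / (K + 1)) := by gcongr; linarith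
    _ = ε := by field_simp

theorem contDiffOn_comp {f H : ℝ → ℝ} {a b c d : ℝ}
    (hf : AbsolutelyContinuousOnInterval f a b) (hH : ContDiffOn ℝ 1 H (Icc c d))
    (hs : MapsTo f (uIcc a b) (Icc c d)) :
    AbsolutelyContinuousOnInterval (fun x => H (f x)) a b := by
  obtain ⟨K, hK⟩ := hH.exists_lipschitzOnWith (by decide) (convex_Icc _ _) isCompact_Icc
  exact hf.lipschitzOnWith_comp hK hs

theorem contDiff_comp {f H : ℝ → ℝ} {a b : ℝ}
    (hf : AbsolutelyContinuousOnInterval f a b) (hH : ContDiff ℝ 1 H) :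
    AbsolutelyContinuousOnInterval (fun x => H (f x)) a b := by
  obtain ⟨C, hC⟩ := hf.exists_bound
  exact hf.contDiffOn_comp (c := -C) (d := C) hH.contDiffOn
    fun x hx => abs_le.1 (hC x hx)

theorem eq_add_integral_deriv {f : ℝ → ℝ} {a b x : ℝ}
    (hf : AbsolutelyContinuousOnInterval f a b) (hx : x ∈ uIcc a b) :
    f x = f a + ∫ t in a..x, deriv f t := by
  rw [(hf.mono (uIcc_subset_uIcc_left hx)).integral_deriv_eq_sub]; ring

/-- A continuous function on `[a,b]` that is absolutely continuous on the compact subintervals of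
`(a,b)` and has an integrable derivative is absolutely continuous on `[a,b]`. -/
theorem of_forall_Ioo {f : ℝ → ℝ} {a b : ℝ} (hab : a < b)
    (hf : ∀ c d, a < c → c ≤ d → d < b → AbsolutelyContinuousOnInterval f c d)
    (hc : ContinuousOn f (Icc a b)) (hi : IntervalIntegrable (deriv f) volume a b) :
    AbsolutelyContinuousOnInterval f a b := by
  set m := (a + b) / 2 with hm
  have ham : a < m := by rw [hm]; linarith
  have hmb : m < b := by rw [hm]; linarith
  have hmu : m ∈ uIcc a b := by rw [uIcc_of_le hab.le]; exact ⟨ham.le, hmb.le⟩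
  have hF := hi.absolutelyContinuousOnInterval_intervalIntegral hmu
  have hc0 : AbsolutelyContinuousOnInterval (fun _ : ℝ => f m) a b :=
    contDiff_const.contDiffOn.absolutelyContinuousOnInterval
  have hF' := hc0.fun_add hF
  refine hF'.congr_eqOn ?_
  rw [uIcc_of_le hab.le]
  have hcF := hF'.continuousOn
  rw [uIcc_of_le hab.le] at hcF
  -- Integrating the derivative from the midpoint recovers f in the interior; continuity on both
  -- sides extends the identity to the endpoints.
  have key : EqOn (fun x => f m + ∫ v in m..x, deriv f v) f (Ioo a b) := by
    intro x hx
    have hx1 : AbsolutelyContinuousOnInterval f m x := by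
      rcases le_total m x with h | h
      · exact hf m x ham h hx.2
      · exact (hf x m hx.1 h hmb).symm
    have := hx1.integral_deriv_eq_sub
    simp only [this]; ring
  exact key.of_subset_closure hcF hc Ioo_subset_Icc_self (by rw [closure_Ioo hab.ne])

theorem of_hasDerivAt {f f' : ℝ → ℝ} {a b : ℝ} (hf : ∀ x ∈ uIcc a b, HasDerivAt f (f' x) x)
    (hf' : ContinuousOn f' (uIcc a b)) : AbsolutelyContinuousOnInterval f a b := by
  obtain ⟨C, hC⟩ := isCompact_uIcc.exists_bound_of_continuousOn hf'
  have : LipschitzOnWith (Real.toNNReal C) f (uIcc a b) := by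
    refine Convex.lipschitzOnWith_of_nnnorm_hasDerivWithin_le (f' := f') (convex_uIcc _ _)
      (fun x hx => (hf x hx).hasDerivWithinAt) fun x hx => ?_
    rw [← NNReal.coe_le_coe, coe_nnnorm]
    exact (hC x hx).trans (Real.le_coe_toNNReal C)
  exact this.absolutelyContinuousOnInterval

end AbsolutelyContinuousOnInterval

namespace ObstacleProblem


/-! ### Test functions and weak derivatives on (0,1). -/

/-- Integration by parts can then be done on a compact subinterval of (0,1) without boundary terms,
which is all that local absolute continuity permits. -/
theorem IsTestFun.exists_Icc {φ : ℝ → ℝ} (hφ : IsTestFun φ) :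
    ∃ a b : ℝ, 0 < a ∧ a < b ∧ b < 1 ∧ tsupport φ ⊆ Icc a b ∧ φ a = 0 ∧ φ b = 0 := by
  obtain ⟨a, b, ha, hab, hb, h⟩ : ∃ a b : ℝ, 0 < a ∧ a < b ∧ b < 1 ∧ tsupport φ ⊆ Ioo a b := by
    rcases (tsupport φ).eq_empty_or_nonempty with h | h
    · exact ⟨1/3, 2/3, by norm_num, by norm_num, by norm_num, by simp [h]⟩
    · have hc : IsCompact (tsupport φ) := hφ.compact
      have h1 := hφ.support (hc.sInf_mem h)
      have h2 := hφ.support (hc.sSup_mem h)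
      have h3 : sInf (tsupport φ) ≤ sSup (tsupport φ) := csInf_le hc.bddBelow (hc.sSup_mem h)
      refine ⟨sInf (tsupport φ) / 2, (sSup (tsupport φ) + 1) / 2, by linarith [h1.1],
        by linarith [h1.1, h2.2], by linarith [h2.2], fun x hx => ?_⟩
      have h4 := csInf_le hc.bddBelow hx
      have h5 := le_csSup hc.bddAbove hx
      constructor <;> linarith [h1.1, h2.2]
  refine ⟨a, b, ha, hab, hb, h.trans Ioo_subset_Icc_self, ?_, ?_⟩
  · exact image_eq_zero_of_notMem_tsupport fun hx => lt_irrefl _ (h hx).1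
  · exact image_eq_zero_of_notMem_tsupport fun hx => lt_irrefl _ (h hx).2

theorem IsTestFun.continuous {φ : ℝ → ℝ} (hφ : IsTestFun φ) : Continuous φ := hφ.smooth.continuous

theorem IsTestFun.continuous_deriv {φ : ℝ → ℝ} (hφ : IsTestFun φ) : Continuous (deriv φ) :=
  hφ.smooth.continuous_deriv (by simp)

theorem IsTestFun.hasDerivAt {φ : ℝ → ℝ} (hφ : IsTestFun φ) (x : ℝ) :
    HasDerivAt φ (deriv φ x) x :=
  (hφ.smooth.differentiable (by simp) x).hasDerivAt

theorem IsTestFun.zero_of_notMem {φ : ℝ → ℝ} (hφ : IsTestFun φ) {x : ℝ} (hx : x ∉ Ioo (0:ℝ) 1) :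
    φ x = 0 :=
  image_eq_zero_of_notMem_tsupport fun h => hx (hφ.support h)

theorem IsTestFun.deriv_zero_of_notMem {φ : ℝ → ℝ} {x : ℝ}
    (hx : x ∉ tsupport φ) : deriv φ x = 0 := by
  by_contra h
  exact hx (support_deriv_subset h)

theorem IsTestFun.absolutelyContinuous {φ : ℝ → ℝ} (hφ : IsTestFun φ) (a b : ℝ) :
    AbsolutelyContinuousOnInterval φ a b :=
  (hφ.smooth.of_le (by simp)).contDiffOn.absolutelyContinuousOnInterval

theorem IsTestFun.add {φ χ : ℝ → ℝ} (hφ : IsTestFun φ) (hχ : IsTestFun χ) :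
    IsTestFun (fun x => φ x + χ x) :=
  ⟨hφ.smooth.add hχ.smooth, hφ.compact.add hχ.compact,
    (closure_mono (Function.support_add φ χ)).trans (by
      rw [closure_union]; exact union_subset hφ.support hχ.support)⟩

theorem IsTestFun.const_mul {φ : ℝ → ℝ} (hφ : IsTestFun φ) (c : ℝ) :
    IsTestFun (fun x => c * φ x) :=
  ⟨contDiff_const.mul hφ.smooth, hφ.compact.mul_left,
    (closure_mono (Function.support_mul_subset_right _ φ)).trans hφ.support⟩

/-- A locally integrable function times a continuous function supported in a compact subset of
`(0,1)` is integrable. -/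
theorem integrableOn_mul_of_tsupport {f φ : ℝ → ℝ} (hf : LocallyIntegrableOn f (Ioo 0 1))
    (hφ : Continuous φ) {K : Set ℝ} (hK : IsCompact K) (hK' : K ⊆ Ioo 0 1)
    (hs : ∀ x ∉ K, φ x = 0) : IntegrableOn (fun x => f x * φ x) (Ioo 0 1) := by
  have h1 : IntegrableOn f K := hf.integrableOn_compact_subset hK' hK
  have h2 : IntegrableOn (fun x => f x * φ x) K := h1.mul_continuousOn hφ.continuousOn hK
  have h3 : (fun x => f x * φ x) = K.indicator (fun x => f x * φ x) := by
    ext x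
    by_cases hx : x ∈ K
    · simp [hx]
    · simp [hx, hs x hx]
  rw [h3]
  exact (h2.integrable_indicator hK.measurableSet).integrableOn

theorem IsTestFun.integrableOn_mul {f φ : ℝ → ℝ} (hφ : IsTestFun φ)
    (hf : LocallyIntegrableOn f (Ioo 0 1)) : IntegrableOn (fun x => f x * φ x) (Ioo 0 1) :=
  integrableOn_mul_of_tsupport hf hφ.continuous hφ.compact hφ.support
    fun _ hx => image_eq_zero_of_notMem_tsupport hx

theorem IsTestFun.integrableOn_mul_deriv {f φ : ℝ → ℝ} (hφ : IsTestFun φ)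
    (hf : LocallyIntegrableOn f (Ioo 0 1)) : IntegrableOn (fun x => f x * deriv φ x) (Ioo 0 1) :=
  integrableOn_mul_of_tsupport hf hφ.continuous_deriv hφ.compact hφ.support
    fun _ hx => IsTestFun.deriv_zero_of_notMem hx

/-- Fundamental lemma of the calculus of variations on `(0,1)`. -/
theorem ae_eq_zero_of_forall_integral {f : ℝ → ℝ} (hf : LocallyIntegrableOn f (Ioo 0 1))
    (h : ∀ φ, IsTestFun φ → ∫ x in Ioo (0:ℝ) 1, f x * φ x = 0) : f =ᵐ[volume.restrict (Ioo 0 1)] 0 := by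
  have := isOpen_Ioo.ae_eq_zero_of_integral_contDiff_smul_eq_zero (μ := volume) hf
    (fun φ h1 h2 h3 => by
      have hφ : IsTestFun φ := ⟨h1, h2, h3⟩
      rw [← h φ hφ, ← setIntegral_eq_integral_of_forall_compl_eq_zero (s := Ioo (0:ℝ) 1)]
      · simp only [smul_eq_mul, mul_comm]
      · intro x hx
        simp [hφ.zero_of_notMem hx])
  exact (ae_restrict_iff' measurableSet_Ioo).2 this

theorem HasWeakDeriv.ae_eq {f g g' : ℝ → ℝ} (h : HasWeakDeriv f g) (h' : HasWeakDeriv f g') :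
    g =ᵐ[volume.restrict (Ioo 0 1)] g' := by
  have := ae_eq_zero_of_forall_integral (h.locInt_deriv.sub h'.locInt_deriv) (fun φ hφ => by
    have e1 := h.parts φ hφ
    have e2 := h'.parts φ hφ
    have : ∀ x, (g - g') x * φ x = g x * φ x - g' x * φ x := fun x => by
      simp [sub_mul]
    simp only [this]
    rw [integral_sub (hφ.integrableOn_mul h.locInt_deriv) (hφ.integrableOn_mul h'.locInt_deriv)]
    linarith)
  filter_upwards [this] with x hx
  simpa [sub_eq_zero] using hx

theorem locallyIntegrableOn_congr {f f' : ℝ → ℝ} (hf : LocallyIntegrableOn f (Ioo 0 1))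
    (h : f =ᵐ[volume.restrict (Ioo 0 1)] f') : LocallyIntegrableOn f' (Ioo 0 1) := by
  rw [locallyIntegrableOn_iff isOpen_Ioo.isLocallyClosed] at hf ⊢
  intro K hK hc
  exact (hf K hK hc).congr_fun_ae (ae_restrict_of_ae_restrict_of_subset hK h)

theorem HasWeakDeriv.congr {f f' g g' : ℝ → ℝ} (h : HasWeakDeriv f g) (hf : f =ᵐ[volume.restrict (Ioo 0 1)] f')
    (hg : g =ᵐ[volume.restrict (Ioo 0 1)] g') : HasWeakDeriv f' g' where
  locInt := locallyIntegrableOn_congr h.locInt hf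
  locInt_deriv := locallyIntegrableOn_congr h.locInt_deriv hg
  parts φ hφ := by
    have e1 : ∫ x in Ioo (0:ℝ) 1, f' x * deriv φ x = ∫ x in Ioo (0:ℝ) 1, f x * deriv φ x :=
      integral_congr_ae (by filter_upwards [hf] with x hx; rw [hx])
    have e2 : ∫ x in Ioo (0:ℝ) 1, g' x * φ x = ∫ x in Ioo (0:ℝ) 1, g x * φ x :=
      integral_congr_ae (by filter_upwards [hg] with x hx; rw [hx])
    rw [e1, e2, h.parts φ hφ]

theorem HasWeakDeriv.weakDeriv {f g : ℝ → ℝ} (h : HasWeakDeriv f g) :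
    HasWeakDeriv f (weakDeriv f) := by
  have : ∃ g, HasWeakDeriv f g := ⟨g, h⟩
  unfold ObstacleProblem.weakDeriv
  rw [dif_pos this]
  exact this.choose_spec

theorem HasWeakDeriv.weakDeriv_ae_eq {f g : ℝ → ℝ} (h : HasWeakDeriv f g) :
    ObstacleProblem.weakDeriv f =ᵐ[volume.restrict (Ioo 0 1)] g :=
  h.weakDeriv.ae_eq h

theorem MemSobolev.congr {k : ℕ} {q : ℝ≥0∞} {f f' : ℝ → ℝ} (h : MemSobolev k q f)
    (hf : f =ᵐ[volume.restrict (Ioo 0 1)] f') : MemSobolev k q f' := by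
  cases k with
  | zero => exact (memLp_congr_ae hf).1 h
  | succ k =>
    obtain ⟨h1, g, h2, h3⟩ := h
    exact ⟨(memLp_congr_ae hf).1 h1, g, h2.congr hf (ae_eq_refl g), h3⟩

theorem integral_Ioo_eq_interval (f : ℝ → ℝ) {a b : ℝ} (hab : a ≤ b) :
    ∫ x in Ioo a b, f x = ∫ x in a..b, f x := by
  rw [intervalIntegral.integral_of_le hab, integral_Ioc_eq_integral_Ioo]

/-- A function that is absolutely continuous on the compact subintervals of `(0,1)` has its
classical derivative as a weak derivative. -/
theorem HasWeakDeriv.of_absolutelyContinuous {f : ℝ → ℝ}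
    (hf : ∀ c d, 0 < c → c ≤ d → d < 1 → AbsolutelyContinuousOnInterval f c d) :
    HasWeakDeriv f (deriv f) where
  locInt := by
    intro x hx
    refine ⟨Icc (x/2) ((x+1)/2), ?_, ?_⟩
    · exact mem_nhdsWithin_of_mem_nhds (Icc_mem_nhds (by linarith [hx.1]) (by linarith [hx.2]))
    · have h := (hf (x/2) ((x+1)/2) (by linarith [hx.1]) (by linarith [hx.1])
        (by linarith [hx.2])).continuousOn
      rw [uIcc_of_le (by linarith [hx.1])] at h
      exact h.integrableOn_Icc
  locInt_deriv := by
    intro x hx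
    refine ⟨Icc (x/2) ((x+1)/2), ?_, ?_⟩
    · exact mem_nhdsWithin_of_mem_nhds (Icc_mem_nhds (by linarith [hx.1]) (by linarith [hx.2]))
    · have h := (hf (x/2) ((x+1)/2) (by linarith [hx.1]) (by linarith [hx.1])
        (by linarith [hx.2])).intervalIntegrable_deriv
      rwa [intervalIntegrable_iff_integrableOn_Icc_of_le (by linarith [hx.1])] at h
  parts φ hφ := by
    obtain ⟨a, b, ha, hab, hb, hs, h1, h2⟩ := hφ.exists_Icc
    have hsub : Icc a b ⊆ Ioo (0:ℝ) 1 := fun x hx => ⟨ha.trans_le hx.1, hx.2.trans_lt hb⟩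
    have red : ∀ F : ℝ → ℝ, (∀ x ∉ tsupport φ, F x = 0) →
        ∫ x in Ioo (0:ℝ) 1, F x = ∫ x in a..b, F x := by
      intro F hF
      rw [intervalIntegral.integral_of_le hab.le, ← integral_Icc_eq_integral_Ioc]
      exact (setIntegral_eq_of_subset_of_forall_sdiff_eq_zero measurableSet_Ioo hsub
        fun x hx => hF x fun h => hx.2 (hs h))
    rw [red _ fun x hx => by rw [IsTestFun.deriv_zero_of_notMem hx, mul_zero],
      red _ fun x hx => by rw [image_eq_zero_of_notMem_tsupport hx, mul_zero]]
    have := (hf a b ha hab.le hb).integral_mul_deriv_eq_deriv_mul (hφ.absolutelyContinuous a b)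
    rw [this, h1, h2]; ring

theorem HasWeakDeriv.of_absolutelyContinuous_Icc {f : ℝ → ℝ}
    (hf : AbsolutelyContinuousOnInterval f 0 1) : HasWeakDeriv f (deriv f) :=
  .of_absolutelyContinuous fun c d h1 h2 h3 => hf.mono (by
    rw [uIcc_of_le h2, uIcc_of_le zero_le_one]; exact Icc_subset_Icc h1.le h3.le)

theorem HasWeakDeriv.of_hasDerivAt {f f' : ℝ → ℝ} (hf : ∀ x ∈ Ioo (0:ℝ) 1, HasDerivAt f (f' x) x)
    (hf' : ContinuousOn f' (Ioo 0 1)) : HasWeakDeriv f f' := by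
  have h : HasWeakDeriv f (deriv f) := .of_absolutelyContinuous fun c d h1 h2 h3 => by
    have hs : uIcc c d ⊆ Ioo 0 1 := by
      rw [uIcc_of_le h2]; exact fun x hx => ⟨h1.trans_le hx.1, hx.2.trans_lt h3⟩
    exact .of_hasDerivAt (fun x hx => hf x (hs hx)) (hf'.mono hs)
  refine h.congr (ae_eq_refl _) ?_
  filter_upwards [ae_restrict_mem measurableSet_Ioo] with x hx
  exact (hf x hx).deriv

theorem exists_isTestFun_integral_eq_one :
    ∃ χ, IsTestFun χ ∧ ∫ x in Ioo (0:ℝ) 1, χ x = 1 := by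
  let B : ContDiffBump (1/2 : ℝ) := ⟨1/8, 1/4, by norm_num, by norm_num⟩
  have hs : tsupport (B.normed volume) ⊆ Ioo (0:ℝ) 1 := by
    rw [B.tsupport_normed_eq, Real.closedBall_eq_Icc]
    intro x hx
    simp only [B, mem_Icc] at hx
    constructor <;> linarith [hx.1, hx.2]
  refine ⟨B.normed volume, ⟨B.contDiff_normed, B.hasCompactSupport_normed, hs⟩, ?_⟩
  rw [setIntegral_eq_integral_of_forall_compl_eq_zero, B.integral_normed]
  exact fun x hx => image_eq_zero_of_notMem_tsupport fun h => hx (hs h)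

/-- A test function of mean zero has a primitive that is a test function. -/
theorem IsTestFun.primitive {χ : ℝ → ℝ} (hχ : IsTestFun χ)
    (h0 : ∫ x in Ioo (0:ℝ) 1, χ x = 0) :
    IsTestFun (fun x => ∫ t in (0:ℝ)..x, χ t) ∧ deriv (fun x => ∫ t in (0:ℝ)..x, χ t) = χ := by
  have hd : ∀ x, HasDerivAt (fun x => ∫ t in (0:ℝ)..x, χ t) (χ x) x := fun x =>
    hχ.continuous.integral_hasStrictDerivAt 0 x |>.hasDerivAt
  have hderiv : deriv (fun x => ∫ t in (0:ℝ)..x, χ t) = χ := funext fun x => (hd x).deriv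
  refine ⟨?_, hderiv⟩
  obtain ⟨a, b, ha, hab, hb, hs, -, -⟩ := hχ.exists_Icc
  have hz : ∀ x, x ∉ Icc a b → χ x = 0 := fun x hx =>
    image_eq_zero_of_notMem_tsupport fun h => hx (hs h)
  have hsupp : tsupport (fun x => ∫ t in (0:ℝ)..x, χ t) ⊆ Icc a b := by
    refine closure_minimal ?_ isClosed_Icc
    intro x hx
    by_contra hxn
    apply hx
    rcases lt_or_ge x a with h | h
    · show ∫ t in (0:ℝ)..x, χ t = 0
      rw [intervalIntegral.integral_congr (g := fun _ => 0)]
      · simp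
      · intro t ht
        refine hz t fun ht' => ?_
        rcases le_total 0 x with h0x | h0x
        · rw [uIcc_of_le h0x] at ht; linarith [ht.2, ht'.1]
        · rw [uIcc_of_ge h0x] at ht; linarith [ht.2, ht'.1]
    · have hbx : b < x := by
        by_contra hbx
        exact hxn ⟨h, not_lt.1 hbx⟩
      show ∫ t in (0:ℝ)..x, χ t = 0
      -- To the right of the support the primitive equals the total integral of χ, which is zero by
      -- assumption.
      rw [← intervalIntegral.integral_add_adjacent_intervals
        (hχ.continuous.intervalIntegrable 0 1) (hχ.continuous.intervalIntegrable 1 x),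
        ← integral_Ioo_eq_interval _ zero_le_one, h0, zero_add,
        intervalIntegral.integral_congr (g := fun _ => 0)]
      · simp
      · intro t ht
        refine hz t fun ht' => ?_
        rcases le_total 1 x with h0x | h0x
        · rw [uIcc_of_le h0x] at ht; linarith [ht.1, ht'.2]
        · rw [uIcc_of_ge h0x] at ht; linarith [ht.1, ht'.2]
  refine ⟨?_, ?_, hsupp.trans fun x hx => ⟨ha.trans_le hx.1, hx.2.trans_lt hb⟩⟩
  · rw [contDiff_infty_iff_deriv, hderiv]
    exact ⟨fun x => (hd x).differentiableAt, hχ.smooth⟩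
  · exact isCompact_Icc.of_isClosed_subset (isClosed_tsupport _) hsupp

theorem locallyIntegrableOn_const (c : ℝ) : LocallyIntegrableOn (fun _ : ℝ => c) (Ioo 0 1) :=
  (locallyIntegrable_const c).locallyIntegrableOn _

/-- A function with vanishing weak derivative is constant. -/
theorem HasWeakDeriv.exists_ae_eq_const {f : ℝ → ℝ} (h : HasWeakDeriv f 0) :
    ∃ c : ℝ, f =ᵐ[volume.restrict (Ioo 0 1)] fun _ => c := by
  obtain ⟨χ, hχ, hχ1⟩ := exists_isTestFun_integral_eq_one
  refine ⟨∫ x in Ioo (0:ℝ) 1, f x * χ x, ?_⟩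
  set c := ∫ x in Ioo (0:ℝ) 1, f x * χ x with hc
  have hl := h.locInt.sub (locallyIntegrableOn_const c)
  have := ae_eq_zero_of_forall_integral hl fun φ hφ => by
    set I := ∫ x in Ioo (0:ℝ) 1, φ x with hI
    have hφi : IntegrableOn φ (Ioo 0 1) := by
      simpa using hφ.integrableOn_mul (locallyIntegrableOn_const 1)
    have hχi : IntegrableOn χ (Ioo 0 1) := by
      simpa using hχ.integrableOn_mul (locallyIntegrableOn_const 1)
    -- Subtracting I·χ makes the mean zero, so the result is the derivative of a test function and
    -- is annihilated by f.
    have ht := hφ.add (hχ.const_mul (-I))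
    have h0 : ∫ x in Ioo (0:ℝ) 1, (φ x + -I * χ x) = 0 := by
      rw [integral_add hφi (hχi.const_mul _), integral_const_mul, hχ1, ← hI]; ring
    obtain ⟨hp, hd⟩ := ht.primitive h0
    have e := h.parts _ hp
    rw [hd] at e
    have e1 : ∀ x, f x * (φ x + -I * χ x) = f x * φ x + -I * (f x * χ x) := fun x => by ring
    simp only [e1, Pi.zero_apply, zero_mul, integral_zero, neg_zero] at e
    rw [integral_add (hφ.integrableOn_mul h.locInt) ((hχ.integrableOn_mul h.locInt).const_mul _),
      integral_const_mul, ← hc] at e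
    have e2 : ∀ x, (f - fun _ : ℝ => c) x * φ x = f x * φ x - c * φ x := fun x => by
      simp [sub_mul]
    simp only [e2]
    rw [integral_sub (hφ.integrableOn_mul h.locInt) (hφi.const_mul _), integral_const_mul, ← hI]
    linarith
  filter_upwards [this] with x hx
  simpa [sub_eq_zero] using hx

theorem HasWeakDeriv.sub {f g f' g' : ℝ → ℝ} (hf : HasWeakDeriv f f') (hg : HasWeakDeriv g g') :
    HasWeakDeriv (fun x => f x - g x) (fun x => f' x - g' x) where
  locInt := hf.locInt.sub hg.locInt
  locInt_deriv := hf.locInt_deriv.sub hg.locInt_deriv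
  parts φ hφ := by
    simp only [sub_mul]
    rw [integral_sub (hφ.integrableOn_mul_deriv hf.locInt) (hφ.integrableOn_mul_deriv hg.locInt),
      integral_sub (hφ.integrableOn_mul hf.locInt_deriv) (hφ.integrableOn_mul hg.locInt_deriv),
      hf.parts φ hφ, hg.parts φ hφ]
    ring

theorem ae_deriv_primitive {g : ℝ → ℝ} (hg : Integrable g) :
    deriv (fun x => ∫ t in (0:ℝ)..x, g t) =ᵐ[volume] g := by
  filter_upwards [LocallyIntegrable.ae_hasDerivAt_integral hg.locallyIntegrable] with x hx
  exact (hx 0).deriv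

theorem absolutelyContinuous_const_add_primitive {g : ℝ → ℝ} (hg : Integrable g) (c a b : ℝ) :
    AbsolutelyContinuousOnInterval (fun x => c + ∫ t in (0:ℝ)..x, g t) a b := by
  have h0 : AbsolutelyContinuousOnInterval (fun x => ∫ t in (0:ℝ)..x, g t) (min 0 (min a b))
      (max 0 (max a b)) :=
    hg.intervalIntegrable.absolutelyContinuousOnInterval_intervalIntegral (by
      rw [uIcc_of_le ((min_le_left _ _).trans (le_max_left _ _))]
      exact ⟨min_le_left _ _, le_max_left _ _⟩)
  have h1 : AbsolutelyContinuousOnInterval (fun x => ∫ t in (0:ℝ)..x, g t) a b := h0.mono (by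
    rw [uIcc_of_le (a := min 0 (min a b)) ((min_le_left _ _).trans (le_max_left _ _)), uIcc]
    exact Icc_subset_Icc (min_le_right _ _) (le_max_right _ _))
  exact (contDiff_const.contDiffOn.absolutelyContinuousOnInterval :
    AbsolutelyContinuousOnInterval (fun _ : ℝ => c) a b).fun_add h1

/-- A function whose weak derivative is integrable agrees a.e. with an absolutely continuous
function whose derivative is the weak derivative. -/
theorem HasWeakDeriv.exists_absolutelyContinuous {f g : ℝ → ℝ} (h : HasWeakDeriv f g)
    (hg : IntegrableOn g (Ioo 0 1)) :
    ∃ F : ℝ → ℝ, Continuous F ∧ AbsolutelyContinuousOnInterval F 0 1 ∧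
      f =ᵐ[volume.restrict (Ioo 0 1)] F ∧ g =ᵐ[volume.restrict (Ioo 0 1)] deriv F := by
  set g' := (Ioo (0:ℝ) 1).indicator g with hg'
  have hi : Integrable g' := hg.integrable_indicator measurableSet_Ioo
  have hgg : g =ᵐ[volume.restrict (Ioo 0 1)] g' := (indicator_ae_eq_restrict measurableSet_Ioo).symm
  have hd : g' =ᵐ[volume.restrict (Ioo 0 1)] deriv (fun x => ∫ t in (0:ℝ)..x, g' t) :=
    ae_restrict_of_ae (ae_deriv_primitive hi).symm
  have hac := absolutelyContinuous_const_add_primitive hi 0 0 1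
  simp only [zero_add] at hac
  -- f minus the primitive of its weak derivative has weak derivative zero, hence is a constant.
  have h1 := (h.sub (HasWeakDeriv.of_absolutelyContinuous_Icc hac)).congr (ae_eq_refl _)
    (g' := 0) (by
      filter_upwards [hgg, hd] with x h1 h2
      simp [← h2, h1])
  obtain ⟨c, hc⟩ := h1.exists_ae_eq_const
  refine ⟨fun x => c + ∫ t in (0:ℝ)..x, g' t, ?_, absolutelyContinuous_const_add_primitive hi c 0 1,
    ?_, ?_⟩
  · exact continuous_const.add (intervalIntegral.continuous_primitive (fun a b => hi.intervalIntegrable) 0)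
  · filter_upwards [hc] with x hx
    linarith
  · filter_upwards [hgg, hd] with x h1 h2
    rw [h1, h2]
    simp

/-! ### Navier functions as primitives of absolutely continuous functions. -/

theorem one_le_ofReal {p : ℝ} (hp : 1 ≤ p) : 1 ≤ ENNReal.ofReal p := by
  rwa [ENNReal.one_le_ofReal]

theorem eqOn_Icc_of_ae_eq {f g : ℝ → ℝ} (hf : ContinuousOn f (Icc 0 1))
    (hg : ContinuousOn g (Icc 0 1)) (h : f =ᵐ[volume.restrict (Ioo 0 1)] g) :
    EqOn f g (Icc 0 1) := by
  have h1 : EqOn f g (Ioo 0 1) :=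
    Measure.eqOn_Ioo_of_ae_eq volume h
      (hf.mono Ioo_subset_Icc_self) (hg.mono Ioo_subset_Icc_self)
  exact h1.of_subset_closure hf hg Ioo_subset_Icc_self (by rw [closure_Ioo zero_ne_one])

theorem hasDerivAt_of_eq_primitive {f v : ℝ → ℝ} (hv : Continuous v)
    (hf : ∀ x ∈ Icc (0:ℝ) 1, f x = ∫ t in (0:ℝ)..x, v t) {x : ℝ} (hx : x ∈ Ioo (0:ℝ) 1) :
    HasDerivAt f (v x) x := by
  refine (hv.integral_hasStrictDerivAt 0 x).hasDerivAt.congr_of_eventuallyEq ?_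
  filter_upwards [Icc_mem_nhds hx.1 hx.2] with y hy
  exact hf y hy

theorem hasWeakDeriv_of_eq_primitive {f v : ℝ → ℝ} (hv : Continuous v)
    (hf : ∀ x ∈ Icc (0:ℝ) 1, f x = ∫ t in (0:ℝ)..x, v t) : HasWeakDeriv f v :=
  .of_hasDerivAt (fun _ hx => hasDerivAt_of_eq_primitive hv hf hx) hv.continuousOn

/-- This replaces weak derivatives by a genuine continuous v: the second weak derivative is
integrable, so the first has an absolutely continuous representative, and f(0) = 0 fixes the
constant of integration. -/
theorem MemNavier.exists_deriv {p : ℝ} (hp : 1 ≤ p) {f : ℝ → ℝ} (hf : MemNavier p f) :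
    ∃ v : ℝ → ℝ, Continuous v ∧ AbsolutelyContinuousOnInterval v 0 1 ∧
      MemLp (deriv v) (ENNReal.ofReal p) (volume.restrict (Ioo 0 1)) ∧
      ∀ x ∈ Icc (0:ℝ) 1, f x = ∫ t in (0:ℝ)..x, v t := by
  obtain ⟨-, g, hg, hgL, z, hz, hzL⟩ := hf.sobolev
  have hp' := one_le_ofReal hp
  obtain ⟨v, hv, hvac, hgv, hzv⟩ := hz.exists_absolutelyContinuous (hzL.integrable hp')
  obtain ⟨F, hF, hFac, hfF, hgF⟩ := hg.exists_absolutelyContinuous (hgL.integrable hp')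
  refine ⟨v, hv, hvac, (memLp_congr_ae hzv).1 hzL, fun x hx => ?_⟩
  have e := eqOn_Icc_of_ae_eq hf.cont hF.continuousOn hfF
  have hx' : x ∈ uIcc (0:ℝ) 1 := by rwa [uIcc_of_le zero_le_one]
  have h0 : F 0 = 0 := by rw [← e ⟨le_rfl, zero_le_one⟩, hf.left]
  rw [e hx, hFac.eq_add_integral_deriv hx', h0, zero_add, ← integral_Ioo_eq_interval _ hx.1,
    ← integral_Ioo_eq_interval _ hx.1]
  refine integral_congr_ae (ae_restrict_of_ae_restrict_of_subset (Ioo_subset_Ioo_right hx.2) ?_)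
  exact hgF.symm.trans hgv

theorem memLp_of_continuous {f : ℝ → ℝ} {q : ℝ≥0∞} (hf : ContinuousOn f (Icc 0 1)) :
    MemLp f q (volume.restrict (Ioo 0 1)) := by
  obtain ⟨C, hC⟩ := isCompact_Icc.exists_bound_of_continuousOn hf
  exact MemLp.of_bound ((hf.mono Ioo_subset_Icc_self).aestronglyMeasurable measurableSet_Ioo) C
    (by filter_upwards [ae_restrict_mem measurableSet_Ioo] with x hx
        exact hC x (Ioo_subset_Icc_self hx))

theorem MemNavier.of_deriv {p : ℝ} {f v : ℝ → ℝ} (hv : Continuous v)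
    (hac : AbsolutelyContinuousOnInterval v 0 1)
    (hL : MemLp (deriv v) (ENNReal.ofReal p) (volume.restrict (Ioo 0 1)))
    (hf : ∀ x ∈ Icc (0:ℝ) 1, f x = ∫ t in (0:ℝ)..x, v t) (h1 : f 1 = 0) : MemNavier p f where
  sobolev := by
    have hc : ContinuousOn f (Icc 0 1) :=
      (intervalIntegral.continuous_primitive
        (fun a b => hv.intervalIntegrable a b) 0).continuousOn.congr fun x hx => hf x hx
    exact ⟨memLp_of_continuous hc, v, hasWeakDeriv_of_eq_primitive hv hf,
      memLp_of_continuous hv.continuousOn, _, .of_absolutelyContinuous_Icc hac, hL⟩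
  cont := (intervalIntegral.continuous_primitive
        (fun a b => hv.intervalIntegrable a b) 0).continuousOn.congr fun x hx => hf x hx
  left := by rw [hf 0 ⟨le_rfl, zero_le_one⟩]; simp
  right := h1

/-! ### Tails of the contact measure and the flux. -/

theorem antitone_tail (μ : Measure ℝ) [IsFiniteMeasure μ] :
    Antitone fun y : ℝ => μ.real (Icc y 1) :=
  fun _ _ h => measureReal_mono (Icc_subset_Icc_left h)

/-- Integration of an absolutely continuous function against a measure on `[0,1]`. -/
theorem setIntegral_eq_integral_deriv_mul_tail (μ : Measure ℝ) [IsFiniteMeasure μ] {h : ℝ → ℝ}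
    (hac : AbsolutelyContinuousOnInterval h 0 1) (h0 : h 0 = 0) :
    ∫ x in Icc (0:ℝ) 1, h x ∂μ = ∫ y in Ioo (0:ℝ) 1, deriv h y * μ.real (Icc y 1) := by
  -- Fubini: h(x) is the integral of h' over y ≤ x, and exchanging the order leaves the mass of {x ≥
  -- y} in [0,1].
  set F : ℝ → ℝ → ℝ := fun x y => (Iic x).indicator (deriv h) y with hF
  have hi : IntegrableOn (deriv h) (Ioo 0 1) :=
    ((intervalIntegrable_iff_integrableOn_Ioo_of_le zero_le_one).1 hac.intervalIntegrable_deriv)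
  have e1 : ∀ x ∈ Icc (0:ℝ) 1, h x = ∫ y in Ioo (0:ℝ) 1, F x y := by
    intro x hx
    have hx' : x ∈ uIcc (0:ℝ) 1 := by rwa [uIcc_of_le zero_le_one]
    rw [hac.eq_add_integral_deriv hx', h0, zero_add, intervalIntegral.integral_of_le hx.1,
      ← integral_Ioc_eq_integral_Ioo, setIntegral_indicator measurableSet_Iic]
    congr 2
    ext y
    simp only [mem_Ioc, mem_inter_iff, mem_Iic]
    constructor
    · rintro ⟨a, b⟩; exact ⟨⟨a, b.trans hx.2⟩, b⟩
    · rintro ⟨⟨a, b⟩, c⟩; exact ⟨a, c⟩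
  have hint : Integrable (Function.uncurry F)
      ((μ.restrict (Icc 0 1)).prod (volume.restrict (Ioo 0 1))) := by
    have h1 : Integrable (fun z : ℝ × ℝ => deriv h z.2)
        ((μ.restrict (Icc 0 1)).prod (volume.restrict (Ioo 0 1))) := hi.comp_snd _
    have h2 : Function.uncurry F = {z : ℝ × ℝ | z.2 ≤ z.1}.indicator fun z => deriv h z.2 := by
      ext z
      simp [Function.uncurry, hF, indicator]
    rw [h2]
    exact h1.indicator (measurableSet_le measurable_snd measurable_fst)
  rw [setIntegral_congr_fun measurableSet_Icc e1, integral_integral_swap hint]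
  refine setIntegral_congr_fun measurableSet_Ioo fun y hy => ?_
  have e2 : ∀ x, F x y = (Ici y).indicator (fun _ => deriv h y) x := fun x => by
    simp [hF, indicator]
  simp only [e2]
  rw [setIntegral_indicator measurableSet_Ici, setIntegral_const, smul_eq_mul, mul_comm]
  congr 2
  ext x
  simp only [mem_inter_iff, mem_Icc, mem_Ici]
  constructor
  · rintro ⟨⟨a, b⟩, c⟩; exact ⟨c, b⟩
  · rintro ⟨a, b⟩; exact ⟨⟨hy.1.le.trans a, b⟩, a⟩

/-- The function `x ↦ ∫₀ˣ (m - c) / g` that solves the first integral of the Euler–Lagrange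
equation. -/
noncomputable def flux (μ : Measure ℝ) (c : ℝ) (g : ℝ → ℝ) (x : ℝ) : ℝ :=
  ∫ y in (0:ℝ)..x, (μ.real (Icc y 1) - c) / g y

theorem flux_zero {μ : Measure ℝ} {c : ℝ} {g : ℝ → ℝ} : flux μ c g 0 = 0 :=
  intervalIntegral.integral_same

section flux

variable {μ : Measure ℝ} [IsFiniteMeasure μ] {c : ℝ} {g : ℝ → ℝ}

theorem intervalIntegrable_fluxDensity (hg : Continuous g) (hg0 : ∀ x, 0 < g x) (a b : ℝ) :
    IntervalIntegrable (fun y => (μ.real (Icc y 1) - c) / g y) volume a b := by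
  have h1 : IntervalIntegrable (fun y => μ.real (Icc y 1) - c) volume a b :=
    (antitone_tail μ).intervalIntegrable.sub intervalIntegrable_const
  simp only [div_eq_mul_inv]
  exact h1.mul_continuousOn (hg.inv₀ fun x => (hg0 x).ne').continuousOn

theorem continuous_flux (hg : Continuous g) (hg0 : ∀ x, 0 < g x) : Continuous (flux μ c g) :=
  intervalIntegral.continuous_primitive (intervalIntegrable_fluxDensity hg hg0) 0

theorem absolutelyContinuous_flux (hg : Continuous g) (hg0 : ∀ x, 0 < g x) :
    AbsolutelyContinuousOnInterval (flux μ c g) 0 1 :=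
  (intervalIntegrable_fluxDensity hg hg0 0 1).absolutelyContinuousOnInterval_intervalIntegral
    left_mem_uIcc

theorem ae_hasDerivAt_flux (hg : Continuous g) (hg0 : ∀ x, 0 < g x) :
    ∀ᵐ x ∂(volume.restrict (Ioo (0:ℝ) 1)),
      HasDerivAt (flux μ c g) ((μ.real (Icc x 1) - c) / g x) x := by
  rw [ae_restrict_iff' measurableSet_Ioo]
  filter_upwards [(intervalIntegrable_fluxDensity (μ := μ) (c := c) hg hg0 0
    1).ae_hasDerivAt_integral] with x hx hx'
  refine hx ?_ 0 left_mem_uIcc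
  rw [uIcc_of_le zero_le_one]
  exact Ioo_subset_Icc_self hx'

theorem flux_eq_sub (hg : Continuous g) (hg0 : ∀ x, 0 < g x) (x y : ℝ) :
    flux μ c g y - flux μ c g x = ∫ t in x..y, (μ.real (Icc t 1) - c) / g t :=
  intervalIntegral.integral_interval_sub_left (intervalIntegrable_fluxDensity hg hg0 _ _)
    (intervalIntegrable_fluxDensity hg hg0 _ _)

/-- The constant is the mean of the tail with respect to the weight 1/g. -/
theorem exists_flux_one_eq_zero (μ : Measure ℝ) [IsFiniteMeasure μ]
    (hg : Continuous g) (hg0 : ∀ x, 0 < g x) :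
    ∃ c, flux μ c g 1 = 0 := by
  have hI : 0 < ∫ y in (0:ℝ)..1, (g y)⁻¹ := by
    refine intervalIntegral.intervalIntegral_pos_of_pos
      ((hg.inv₀ fun x => (hg0 x).ne').intervalIntegrable _ _) (fun x => inv_pos.2 (hg0 x)) one_pos
  refine ⟨(∫ y in (0:ℝ)..1, μ.real (Icc y 1) / g y) / ∫ y in (0:ℝ)..1, (g y)⁻¹, ?_⟩
  set c := (∫ y in (0:ℝ)..1, μ.real (Icc y 1) / g y) / ∫ y in (0:ℝ)..1, (g y)⁻¹ with hc
  have e : ∀ y, (μ.real (Icc y 1) - c) / g y = μ.real (Icc y 1) / g y - c * (g y)⁻¹ := fun y => by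
    rw [sub_div, div_eq_mul_inv c]
  unfold flux
  simp only [e]
  have h1 : IntervalIntegrable (fun y => μ.real (Icc y 1) / g y) volume 0 1 := by
    simpa using intervalIntegrable_fluxDensity (μ := μ) (c := 0) hg hg0 0 1
  have h2 : IntervalIntegrable (fun y => c * (g y)⁻¹) volume 0 1 :=
    ((hg.inv₀ fun x => (hg0 x).ne').intervalIntegrable _ _).const_mul c
  rw [intervalIntegral.integral_sub h1 h2,
    intervalIntegral.integral_const_mul, hc, div_mul_cancel₀ _ hI.ne', sub_self]

end flux

/-! ### The integrated Euler–Lagrange equation. -/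

theorem IsAdmissible.contDiff_deriv {G : ℝ → ℝ} (hG : IsAdmissible G) : ContDiff ℝ ∞ (deriv G) :=
  (contDiff_infty_iff_deriv.1 hG.smooth).2

theorem IsAdmissible.continuous_deriv {G : ℝ → ℝ} (hG : IsAdmissible G) : Continuous (deriv G) :=
  hG.contDiff_deriv.continuous

/-- Euler's substitution in terms of a continuous representative `v` of `u'`. -/
theorem eulerSubst_ae_eq {p : ℝ} {G u v : ℝ → ℝ} (hv : Continuous v)
    (hac : AbsolutelyContinuousOnInterval v 0 1)
    (hu : ∀ x ∈ Icc (0:ℝ) 1, u x = ∫ t in (0:ℝ)..x, v t) :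
    eulerSubst p G u =ᵐ[volume.restrict (Ioo 0 1)]
      fun x => -p * deriv G (v x) ^ (p - 1) * (|deriv v x| ^ (p - 2) * deriv v x) := by
  have h1 := hasWeakDeriv_of_eq_primitive hv hu
  have h2 := (HasWeakDeriv.of_absolutelyContinuous_Icc hac).congr h1.weakDeriv_ae_eq.symm
    (ae_eq_refl _)
  filter_upwards [h1.weakDeriv_ae_eq, h2.weakDeriv_ae_eq] with x hx1 hx2
  rw [eulerSubst, hx1, hx2]

theorem abs_rpow_sub_two_mul_abs {p t : ℝ} (hp : 1 < p) : |t| ^ (p - 2) * |t| = |t| ^ (p - 1) := by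
  rcases eq_or_ne t 0 with rfl | h
  · rw [abs_zero, mul_zero, Real.zero_rpow (by linarith)]
  · rw [← Real.rpow_add_one (abs_pos.2 h).ne']; congr 1; ring

theorem integrableOn_eulerSubst {p : ℝ} (hp : 1 < p) {G v : ℝ → ℝ} (hG : IsAdmissible G)
    (hv : Continuous v)
    (hL : MemLp (deriv v) (ENNReal.ofReal p) (volume.restrict (Ioo 0 1))) :
    IntegrableOn (fun x => -p * deriv G (v x) ^ (p - 1) * (|deriv v x| ^ (p - 2) * deriv v x))
      (Ioo 0 1) := by
  have hc : Continuous fun x => -p * deriv G (v x) ^ (p - 1) :=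
    continuous_const.mul ((hG.continuous_deriv.comp hv).rpow_const fun x => Or.inl
      (hG.deriv_pos _).ne')
  have h1 : Integrable (fun x => |deriv v x| ^ (p - 2) * deriv v x)
      (volume.restrict (Ioo 0 1)) := by
    have h2 : Integrable (fun x => ‖deriv v x‖ ^ p) (volume.restrict (Ioo 0 1)) := by
      have := hL.integrable_norm_rpow (by simp; linarith) (by simp)
      rwa [ENNReal.toReal_ofReal (by linarith)] at this
    -- The dominating function comes from |t|^(p-1) ≤ 1 + |t|^p.
    have h3 : Integrable (fun x => 1 + ‖deriv v x‖ ^ p) (volume.restrict (Ioo 0 1)) :=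
      (integrable_const 1).add h2
    refine h3.mono' ?_ (Eventually.of_forall fun x => ?_)
    · have := measurable_deriv v
      fun_prop
    · simp only [norm_mul, Real.norm_eq_abs]
      rw [
        abs_of_nonneg (Real.rpow_nonneg (abs_nonneg _) _), abs_rpow_sub_two_mul_abs hp]
      rcases le_total |deriv v x| 1 with h | h
      · have := Real.rpow_le_one (abs_nonneg _) h (by linarith : 0 ≤ p - 1)
        have := Real.rpow_nonneg (abs_nonneg (deriv v x)) p
        linarith
      · have := Real.rpow_le_rpow_of_exponent_le h (by linarith : p - 1 ≤ p)
        linarith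
  obtain ⟨C, hC⟩ := (isCompact_Icc (a := (0:ℝ)) (b := 1)).exists_bound_of_continuousOn hc.continuousOn
  refine Integrable.bdd_mul (c := C) h1 hc.aestronglyMeasurable ?_
  filter_upwards [ae_restrict_mem measurableSet_Ioo] with x hx
  exact hC x (Ioo_subset_Icc_self hx)

/-- For a critical point, Euler's substitution solves the integrated Euler–Lagrange equation with
natural boundary conditions. -/
theorem euler_eq_flux {p : ℝ} (hp : 1 < p) {G u v : ℝ → ℝ} (hG : IsAdmissible G)
    (hv : Continuous v) (hac : AbsolutelyContinuousOnInterval v 0 1)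
    (hL : MemLp (deriv v) (ENNReal.ofReal p) (volume.restrict (Ioo 0 1)))
    (hu : ∀ x ∈ Icc (0:ℝ) 1, u x = ∫ t in (0:ℝ)..x, v t)
    {μ : Measure ℝ} [IsFiniteMeasure μ]
    (hEL : ∀ φ, MemNavier p φ →
      -∫ x in Ioo (0 : ℝ) 1, eulerSubst p G u x *
          weakDeriv (fun y => deriv G (weakDeriv u y) * weakDeriv φ y) x
        = ∫ x in Icc (0 : ℝ) 1, φ x ∂μ)
    {c : ℝ} (hc : flux μ c (fun x => deriv G (v x)) 1 = 0) :
    (fun x => -p * deriv G (v x) ^ (p - 1) * (|deriv v x| ^ (p - 2) * deriv v x))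
      =ᵐ[volume.restrict (Ioo 0 1)] flux μ c (fun x => deriv G (v x)) := by
  set g : ℝ → ℝ := fun x => deriv G (v x) with hgdef
  have hg : Continuous g := hG.continuous_deriv.comp hv
  have hg0 : ∀ x, 0 < g x := fun x => hG.deriv_pos _
  set H : ℝ → ℝ := fun s => (deriv G s)⁻¹ with hH
  have hHs : ContDiff ℝ ∞ H := hG.contDiff_deriv.inv fun s => (hG.deriv_pos s).ne'
  have hHc : Continuous (fun x => H (v x)) := hHs.continuous.comp hv
  have hH'c : Continuous (fun x => deriv H (v x)) := (hHs.continuous_deriv (by simp)).comp hv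
  have hHac : AbsolutelyContinuousOnInterval (fun x => H (v x)) 0 1 :=
    hac.contDiff_comp (hHs.of_le (by simp))
  set w : ℝ → ℝ := fun x => -p * deriv G (v x) ^ (p - 1) * (|deriv v x| ^ (p - 2) * deriv v x)
    with hw
  have hwi : IntegrableOn w (Ioo 0 1) := integrableOn_eulerSubst hp hG hv hL
  set W := flux μ c g with hW
  have hWc : Continuous W := continuous_flux hg hg0
  have hWi : IntegrableOn W (Ioo 0 1) := hWc.continuousOn.integrableOn_Icc.mono_set
    Ioo_subset_Icc_self
  have hWac := absolutelyContinuous_flux (μ := μ) (c := c) hg hg0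
  have hI : 0 < ∫ y in (0:ℝ)..1, H (v y) :=
    intervalIntegral.intervalIntegral_pos_of_pos (hHc.intervalIntegrable _ _)
      (fun x => inv_pos.2 (hg0 x)) one_pos
  have hloc : LocallyIntegrableOn (w - W) (Ioo 0 1) := (hwi.sub hWi).locallyIntegrableOn
  have key := ae_eq_zero_of_forall_integral hloc fun ζ hζ => by
    set Z : ℝ → ℝ := fun x => ∫ t in (0:ℝ)..x, ζ t with hZ
    have hZd : ∀ x, HasDerivAt Z (ζ x) x := fun x =>
      (hζ.continuous.integral_hasStrictDerivAt 0 x).hasDerivAt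
    have hZc : Continuous Z := continuous_iff_continuousAt.2 fun x => (hZd x).continuousAt
    -- The free constant a is spent on φ(1) = 0 below. Hence ζ = η' may be any test function, and w
    -- is determined exactly, not just up to a constant.
    set a := -(∫ y in (0:ℝ)..1, Z y * H (v y)) / ∫ y in (0:ℝ)..1, H (v y) with ha
    set η : ℝ → ℝ := fun x => a + Z x with hη
    have hηd : ∀ x, HasDerivAt η (ζ x) x := fun x => (hZd x).const_add a
    have hηc : Continuous η := continuous_const.add hZc
    have hηac : AbsolutelyContinuousOnInterval η 0 1 :=
      .of_hasDerivAt (fun x _ => hηd x) hζ.continuous.continuousOn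
    set φ₁ : ℝ → ℝ := fun x => η x * H (v x) with hφ₁
    have hφ₁c : Continuous φ₁ := hηc.mul hHc
    have hφ₁ac : AbsolutelyContinuousOnInterval φ₁ 0 1 := hηac.fun_mul hHac
    have hφ₁d : deriv φ₁ =ᵐ[volume.restrict (Ioo 0 1)]
        fun x => ζ x * H (v x) + (η x * deriv H (v x)) * deriv v x := by
      rw [EventuallyEq, ae_restrict_iff' measurableSet_Ioo]
      filter_upwards [hac.ae_differentiableAt] with x hx hx'
      have hx2 := (hx (by rw [uIcc_of_le zero_le_one]; exact Ioo_subset_Icc_self hx')).hasDerivAt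
      have h3 : HasDerivAt H (deriv H (v x)) (v x) :=
        (hHs.differentiable (by simp) _).hasDerivAt
      have h4 : HasDerivAt φ₁ (ζ x * H (v x) + η x * (deriv H (v x) * deriv v x)) x :=
        (hηd x).mul (h3.comp x hx2)
      rw [h4.deriv]
      ring
    have hφ₁L : MemLp (deriv φ₁) (ENNReal.ofReal p) (volume.restrict (Ioo 0 1)) := by
      refine (memLp_congr_ae hφ₁d).2 (MemLp.add ?_ ?_)
      · exact memLp_of_continuous (hζ.continuous.mul hHc).continuousOn
      · obtain ⟨C, hC⟩ := (isCompact_Icc (a := (0:ℝ)) (b := 1)).exists_bound_of_continuousOn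
          (hηc.mul hH'c).continuousOn
        refine MemLp.of_le_mul (c := C) hL ?_ ?_
        · exact (hηc.mul hH'c).aestronglyMeasurable.mul hL.aestronglyMeasurable
        · filter_upwards [ae_restrict_mem measurableSet_Ioo] with x hx
          rw [norm_mul]
          exact mul_le_mul_of_nonneg_right (hC x (Ioo_subset_Icc_self hx)) (norm_nonneg _)
    -- Since φ' = η/G'(u'), the function differentiated in the Euler–Lagrange equation is η, whose
    -- derivative is ζ.
    set φ : ℝ → ℝ := fun x => ∫ t in (0:ℝ)..x, φ₁ t with hφ
    have hφd : ∀ x, HasDerivAt φ (φ₁ x) x := fun x =>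
      (hφ₁c.integral_hasStrictDerivAt 0 x).hasDerivAt
    have hφ1 : φ 1 = 0 := by
      have e : ∀ x, φ₁ x = a * H (v x) + Z x * H (v x) := fun x => by
        simp only [hφ₁, hη]; ring
      simp only [hφ, e]
      have i1 : IntervalIntegrable (fun x => a * H (v x)) volume 0 1 :=
        (continuous_const.mul hHc).intervalIntegrable _ _
      have i2 : IntervalIntegrable (fun x => Z x * H (v x)) volume 0 1 :=
        (hZc.mul hHc).intervalIntegrable _ _
      rw [intervalIntegral.integral_add i1 i2, intervalIntegral.integral_const_mul, ha,
        div_mul_cancel₀ _ hI.ne']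
      ring
    have hφN : MemNavier p φ := MemNavier.of_deriv hφ₁c hφ₁ac hφ₁L (fun _ _ => rfl) hφ1
    have hEL' := hEL φ hφN
    have hwu := (hasWeakDeriv_of_eq_primitive hv hu).weakDeriv_ae_eq
    have hwφ := (hasWeakDeriv_of_eq_primitive hφ₁c (f := φ) fun _ _ => rfl).weakDeriv_ae_eq
    have hηw : HasWeakDeriv η ζ :=
      .of_hasDerivAt (fun x _ => hηd x) hζ.continuous.continuousOn
    have hprod : η =ᵐ[volume.restrict (Ioo 0 1)]
        fun y => deriv G (weakDeriv u y) * weakDeriv φ y := by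
      filter_upwards [hwu, hwφ] with x h1 h2
      rw [h1, h2, hφ₁]
      simp only [hH]
      field_simp [(hG.deriv_pos (v x)).ne']
    have hwη := (hηw.congr hprod (ae_eq_refl ζ)).weakDeriv_ae_eq
    have hL1 : ∫ x in Ioo (0 : ℝ) 1, eulerSubst p G u x *
          weakDeriv (fun y => deriv G (weakDeriv u y) * weakDeriv φ y) x =
        ∫ x in Ioo (0 : ℝ) 1, w x * ζ x := by
      refine integral_congr_ae ?_
      filter_upwards [hwη, eulerSubst_ae_eq hv hac hu (p := p) (G := G)] with x h1 h2
      rw [h1, h2]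
    have hφac : AbsolutelyContinuousOnInterval φ 0 1 :=
      .of_hasDerivAt (fun x _ => hφd x) hφ₁c.continuousOn
    rw [hL1, setIntegral_eq_integral_deriv_mul_tail μ hφac intervalIntegral.integral_same] at hEL'
    have hdφ : deriv φ = φ₁ := funext fun x => (hφd x).deriv
    rw [hdφ, integral_Ioo_eq_interval _ zero_le_one, integral_Ioo_eq_interval _ zero_le_one]
      at hEL'
    have hm : IntervalIntegrable (fun y => φ₁ y * μ.real (Icc y 1)) volume 0 1 :=
      (antitone_tail μ).intervalIntegrable.continuousOn_mul hφ₁c.continuousOn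
    -- W' = (m - c)/g, and the c-part drops out because φ' has mean zero.
    have hsub : ∫ y in (0:ℝ)..1, η y * deriv W y = ∫ y in (0:ℝ)..1, φ₁ y * μ.real (Icc y 1) := by
      have e1 : ∫ y in (0:ℝ)..1, η y * deriv W y
          = ∫ y in (0:ℝ)..1, (φ₁ y * μ.real (Icc y 1) - c * φ₁ y) := by
        rw [← integral_Ioo_eq_interval _ zero_le_one, ← integral_Ioo_eq_interval _ zero_le_one]
        refine integral_congr_ae ?_
        filter_upwards [ae_hasDerivAt_flux (μ := μ) (c := c) hg hg0] with x hx
        rw [hx.deriv]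
        simp only [hφ₁, hH, hgdef]
        ring
      have i1 : IntervalIntegrable (fun x => c * φ₁ x) volume 0 1 :=
        (continuous_const.mul hφ₁c).intervalIntegrable _ _
      rw [e1, intervalIntegral.integral_sub hm i1,
        intervalIntegral.integral_const_mul]
      have : ∫ y in (0:ℝ)..1, φ₁ y = 0 := hφ1
      rw [this]; ring
    have hparts := hηac.integral_mul_deriv_eq_deriv_mul hWac
    have hdη : deriv η = ζ := funext fun x => (hηd x).deriv
    -- η need not vanish at 0 and 1; the boundary terms disappear because W does. This is where the
    -- natural boundary conditions enter.
    rw [← hW, hsub, hc, hW, flux_zero, ← hW, hdη, ← hEL'] at hparts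
    have e3 : ∀ x, (w - W) x * ζ x = w x * ζ x - W x * ζ x := fun x => by
      simp [sub_mul]
    simp only [e3]
    rw [integral_sub (hζ.integrableOn_mul hwi.locallyIntegrableOn)
      (hζ.integrableOn_mul hWi.locallyIntegrableOn), integral_Ioo_eq_interval _ zero_le_one,
      integral_Ioo_eq_interval _ zero_le_one]
    have e4 : ∫ x in (0:ℝ)..1, W x * ζ x = ∫ x in (0:ℝ)..1, ζ x * W x := by
      simp only [mul_comm]
    rw [e4]
    linarith
  filter_upwards [key] with x hx
  simpa [sub_eq_zero] using hx

/-! ### The flux grows linearly from both ends. -/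

theorem mul_sub_le_intervalIntegral {f : ℝ → ℝ} {a b K : ℝ} (hab : a ≤ b)
    (hf : IntervalIntegrable f volume a b) (h : ∀ y ∈ Ioo a b, K ≤ f y) :
    K * (b - a) ≤ ∫ y in a..b, f y := by
  have := intervalIntegral.integral_mono_on_of_le_Ioo hab
    (intervalIntegrable_const (μ := volume) (c := K)) hf h
  rwa [intervalIntegral.integral_const, smul_eq_mul, mul_comm] at this

theorem intervalIntegral_le_mul_sub {f : ℝ → ℝ} {a b K : ℝ} (hab : a ≤ b)
    (hf : IntervalIntegrable f volume a b) (h : ∀ y ∈ Ioo a b, f y ≤ K) :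
    ∫ y in a..b, f y ≤ K * (b - a) := by
  have := intervalIntegral.integral_mono_on_of_le_Ioo hab hf
    (intervalIntegrable_const (μ := volume) (c := K)) h
  rwa [intervalIntegral.integral_const, smul_eq_mul, mul_comm] at this

/-- The tail is nonincreasing, so the flux increases as long as the tail is at least c and decreases
afterwards. On the outer pieces of length δ the tail is M or 0, and the flux has slope at least (M -
c)/Γ, respectively at most -c/Γ, where Γ bounds g. -/
theorem flux_lower_bound {μ : Measure ℝ} [IsFiniteMeasure μ] {c : ℝ} {g : ℝ → ℝ}
    (hg : Continuous g) (hg0 : ∀ x, 0 < g x) (h1 : flux μ c g 1 = 0) {δ M : ℝ} (hδ : 0 < δ)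
    (hδ' : δ < 1 / 2) (hM : 0 < M) (hl : ∀ y ≤ δ, μ.real (Icc y 1) = M)
    (hr : ∀ y, 1 - δ < y → μ.real (Icc y 1) = 0) :
    0 < c ∧ c < M ∧ ∃ k > 0, ∀ x ∈ Icc (0:ℝ) 1, k * (x * (1 - x)) ≤ flux μ c g x := by
  obtain ⟨Γ, hΓ⟩ := (isCompact_Icc (a := (0:ℝ)) (b := 1)).exists_bound_of_continuousOn
    hg.continuousOn
  have hgΓ : ∀ x ∈ Icc (0:ℝ) 1, g x ≤ Γ := fun x hx => (le_abs_self _).trans (hΓ x hx)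
  have hΓ0 : 0 < Γ := (hg0 0).trans_le (hgΓ 0 ⟨le_rfl, zero_le_one⟩)
  set m : ℝ → ℝ := fun y => μ.real (Icc y 1) with hm
  have hanti : Antitone m := antitone_tail μ
  have hm0 : ∀ y, 0 ≤ m y := fun y => measureReal_nonneg
  have hmM : ∀ y, 0 ≤ y → m y ≤ M := fun y hy => by
    rw [← hl 0 hδ.le]; exact hanti hy
  have hint := intervalIntegrable_fluxDensity (μ := μ) (c := c) hg hg0
  have hsub := flux_eq_sub (μ := μ) (c := c) hg hg0
  have hf0 : flux μ c g 0 = 0 := flux_zero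
  -- elementary bounds for the density
  have lowl : c ≤ M → ∀ y ∈ Icc (0:ℝ) 1, y ≤ δ → (M - c) / Γ ≤ (m y - c) / g y := by
    intro hcM y hy hyδ
    simp only [hm, hl y hyδ]
    exact div_le_div_of_nonneg_left (by linarith) (hg0 y) (hgΓ y hy)
  have upr : 0 ≤ c → ∀ y ∈ Icc (0:ℝ) 1, 1 - δ < y → (m y - c) / g y ≤ -(c / Γ) := by
    intro hc y hy hyδ
    simp only [hm, hr y hyδ, zero_sub, neg_div]
    exact neg_le_neg (div_le_div_of_nonneg_left hc (hg0 y) (hgΓ y hy))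
  have pos_part : ∀ a b, 0 ≤ a → a ≤ b → b ≤ 1 → (∀ y ∈ Ioo a b, c ≤ m y) →
      flux μ c g a ≤ flux μ c g b := by
    intro a b _ hab _ h
    have := mul_sub_le_intervalIntegral (K := 0) hab (hint a b)
      fun y hy => div_nonneg (sub_nonneg.2 (h y hy)) (hg0 y).le
    linarith [hsub a b]
  have neg_part : ∀ a b, 0 ≤ a → a ≤ b → b ≤ 1 → (∀ y ∈ Ioo a b, m y ≤ c) →
      flux μ c g b ≤ flux μ c g a := by
    intro a b _ hab _ h
    have := intervalIntegral_le_mul_sub (K := 0) hab (hint a b)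
      fun y hy => div_nonpos_of_nonpos_of_nonneg (sub_nonpos.2 (h y hy)) (hg0 y).le
    linarith [hsub a b]
  have left_part : c ≤ M → ∀ x, 0 ≤ x → x ≤ δ → (M - c) / Γ * x ≤ flux μ c g x := by
    intro hcM x hx hxδ
    have := mul_sub_le_intervalIntegral (K := (M - c) / Γ) hx (hint 0 x)
      fun y hy => lowl hcM y ⟨hy.1.le, by linarith [hy.2]⟩ (by linarith [hy.2])
    have h2 := hsub 0 x
    rw [hf0, sub_zero] at h2
    rw [h2]; linarith
  have right_part : 0 ≤ c → ∀ x, 1 - δ ≤ x → x ≤ 1 → c / Γ * (1 - x) ≤ flux μ c g x := by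
    intro hc x hx hx1
    have := intervalIntegral_le_mul_sub (K := -(c / Γ)) hx1 (hint x 1)
      fun y hy => upr hc y ⟨by linarith [hy.1], hy.2.le⟩ (by linarith [hy.1])
    have h2 := hsub x 1
    rw [h1] at h2
    linarith
  -- If c ≤ 0, the flux would be positive at δ and nondecreasing from there on, so it could not
  -- vanish at 1. The bound c < M is the mirror image.
  have hc0 : 0 < c := by
    by_contra hc
    push Not at hc
    have e1 := left_part (by linarith) δ hδ.le le_rfl
    have e2 := pos_part δ 1 hδ.le (by linarith) le_rfl fun y _ => hc.trans (hm0 y)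
    have : 0 < (M - c) / Γ * δ := by
      have : 0 < M - c := by linarith
      positivity
    linarith
  have hcM : c < M := by
    by_contra hc
    push Not at hc
    have e1 := right_part hc0.le (1 - δ) le_rfl (by linarith)
    have e2 := neg_part 0 (1 - δ) le_rfl (by linarith) (by linarith)
      fun y hy => (hmM y hy.1.le).trans hc
    have : 0 < c / Γ * (1 - (1 - δ)) := by
      have : (1:ℝ) - (1 - δ) = δ := by ring
      rw [this]; positivity
    linarith
  refine ⟨hc0, hcM, δ * min (M - c) c / Γ, ?_, fun x hx => ?_⟩
  · have : 0 < min (M - c) c := lt_min (by linarith) hc0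
    positivity
  have hxx : 0 ≤ x * (1 - x) := mul_nonneg hx.1 (by linarith [hx.2])
  -- On the rising side compare with the left end piece, on the falling side with the right one.
  rcases le_or_gt c (m x) with h | h
  · have b1 : δ * min (M - c) c / Γ ≤ δ * ((M - c) / Γ) := by
      rw [mul_div_assoc]; gcongr; exact min_le_left _ _
    have hk : 0 ≤ (M - c) / Γ := div_nonneg (by linarith) hΓ0.le
    have b2 : (M - c) / Γ * min x δ ≤ flux μ c g x := by
      rcases le_total x δ with hxδ | hxδ
      · rw [min_eq_left hxδ]; exact left_part hcM.le x hx.1 hxδ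
      · rw [min_eq_right hxδ]
        exact (left_part hcM.le δ hδ.le le_rfl).trans
          (pos_part δ x hδ.le hxδ hx.2 fun y hy => h.trans (hanti hy.2.le))
    have b3 : δ * (x * (1 - x)) ≤ min x δ := by
      refine le_min ?_ (mul_le_of_le_one_right hδ.le (by nlinarith [hx.1, hx.2]))
      exact (mul_le_of_le_one_left hxx (by linarith)).trans
        (mul_le_of_le_one_right hx.1 (by linarith [hx.1]))
    calc _ ≤ δ * ((M - c) / Γ) * (x * (1 - x)) := mul_le_mul_of_nonneg_right b1 hxx
      _ = (M - c) / Γ * (δ * (x * (1 - x))) := by ring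
      _ ≤ (M - c) / Γ * min x δ := mul_le_mul_of_nonneg_left b3 hk
      _ ≤ _ := b2
  · have b1 : δ * min (M - c) c / Γ ≤ δ * (c / Γ) := by
      rw [mul_div_assoc]; gcongr; exact min_le_right _ _
    have hk : 0 ≤ c / Γ := div_nonneg hc0.le hΓ0.le
    have b2 : c / Γ * min (1 - x) δ ≤ flux μ c g x := by
      rcases le_total (1 - x) δ with hxδ | hxδ
      · rw [min_eq_left hxδ]; exact right_part hc0.le x (by linarith) hx.2
      · rw [min_eq_right hxδ]
        have e1 := right_part hc0.le (1 - δ) le_rfl (by linarith)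
        have e2 := neg_part x (1 - δ) hx.1 (by linarith) (by linarith)
          fun y hy => (hanti hy.1.le).trans h.le
        have : c / Γ * (1 - (1 - δ)) = c / Γ * δ := by ring
        linarith
    have b3 : δ * (x * (1 - x)) ≤ min (1 - x) δ := by
      refine le_min ?_ (mul_le_of_le_one_right hδ.le (by nlinarith [hx.1, hx.2]))
      exact (mul_le_of_le_one_left hxx (by linarith)).trans
        (mul_le_of_le_one_left (by linarith [hx.2]) hx.2)
    calc _ ≤ δ * (c / Γ) * (x * (1 - x)) := mul_le_mul_of_nonneg_right b1 hxx
      _ = c / Γ * (δ * (x * (1 - x))) := by ring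
      _ ≤ c / Γ * min (1 - x) δ := mul_le_mul_of_nonneg_left b3 hk
      _ ≤ _ := b2

/-! ### From a critical point to a formula for its second derivative. -/

/-- W ≥ 0 forces z ≤ 0, and then the equation reads (g|z|)^(p-1) = W/p, which can be inverted. -/
theorem eq_of_eulerSubst_eq {p g z W : ℝ} (hp : 1 < p) (hg : 0 < g) (hW : 0 ≤ W)
    (h : -p * g ^ (p - 1) * (|z| ^ (p - 2) * z) = W) :
    z = -(W / p) ^ (1 / (p - 1)) / g := by
  have hp0 : 0 < p := by linarith
  have hgp : 0 < g ^ (p - 1) := Real.rpow_pos_of_pos hg _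
  have hz : z ≤ 0 := by
    by_contra hz
    push Not at hz
    have : 0 < p * g ^ (p - 1) * (|z| ^ (p - 2) * z) := by
      have := Real.rpow_pos_of_pos (abs_pos.2 hz.ne') (p - 2)
      positivity
    linarith
  have hz' : z = -|z| := by rw [abs_of_nonpos hz, neg_neg]
  have e1 : |z| ^ (p - 2) * z = -|z| ^ (p - 1) := by
    rw [← abs_rpow_sub_two_mul_abs hp]
    nth_rw 2 [hz']
    ring
  have e2 : W / p = (g * |z|) ^ (p - 1) := by
    rw [Real.mul_rpow hg.le (abs_nonneg z), ← h, e1]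
    field_simp
  rw [e2, one_div, Real.rpow_rpow_inv (mul_nonneg hg.le (abs_nonneg z)) (by linarith)]
  nth_rw 1 [hz']
  field_simp

/-- The data of a critical point `u` of the obstacle problem: `v = u'`, the measure `μ`, and the
constant `c` of the first integral. -/
structure CriticalProfile (p : ℝ) (G ψ u v : ℝ → ℝ) (μ : Measure ℝ) (c : ℝ) : Prop where
  finite : IsFiniteMeasure μ
  supp : μ (coincidenceSet ψ u)ᶜ = 0
  cont : Continuous v
  hasDerivAt : ∀ x ∈ Icc (0:ℝ) 1, HasDerivAt v
    (-(flux μ c (fun x => deriv G (v x)) x / p) ^ (1 / (p - 1)) / deriv G (v x)) x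
  primitive : ∀ x ∈ Icc (0:ℝ) 1, u x = ∫ t in (0:ℝ)..x, v t
  right : u 1 = 0
  flux_one : flux μ c (fun x => deriv G (v x)) 1 = 0
  c_pos : 0 < c
  c_lt : c < μ.real univ
  lower : ∃ k > 0, ∀ x ∈ Icc (0:ℝ) 1, k * (x * (1 - x)) ≤ flux μ c (fun x => deriv G (v x)) x

theorem IsCriticalPoint.exists_margin {p : ℝ} {G ψ u : ℝ → ℝ} (hψ : IsObstacle ψ)
    (h : IsCriticalPoint p G ψ u) :
    ∃ δ : ℝ, 0 < δ ∧ δ < 1 / 2 ∧ coincidenceSet ψ u ⊆ Icc δ (1 - δ) := by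
  have hc : ContinuousOn (fun x => u x - ψ x) (Icc 0 1) := h.mem.navier.cont.sub hψ.cont
  have h0 : ∀ᶠ x in 𝓝[Icc 0 1] (0:ℝ), 0 < u x - ψ x :=
    (hc 0 ⟨le_rfl, zero_le_one⟩).eventually_const_lt (by
      simp only [h.mem.navier.left]; linarith [hψ.left])
  have h1 : ∀ᶠ x in 𝓝[Icc 0 1] (1:ℝ), 0 < u x - ψ x :=
    (hc 1 ⟨zero_le_one, le_rfl⟩).eventually_const_lt (by
      simp only [h.mem.navier.right]; linarith [hψ.right])
  rw [eventually_nhdsWithin_iff, Metric.eventually_nhds_iff] at h0 h1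
  obtain ⟨ε, hε, H0⟩ := h0
  obtain ⟨ε', hε', H1⟩ := h1
  refine ⟨min (min ε ε') (1 / 4), by positivity, (min_le_right _ _).trans_lt (by norm_num),
    fun x hx => ⟨?_, ?_⟩⟩
  · by_contra hlt
    push Not at hlt
    have hxε : x < ε := hlt.trans_le ((min_le_left _ _).trans (min_le_left _ _))
    have := H0 (y := x) (by rw [Real.dist_eq, sub_zero, abs_of_nonneg hx.1.1]; exact hxε) hx.1
    have := hx.2
    linarith
  · by_contra hlt
    push Not at hlt
    have hle : min (min ε ε') (1 / 4) ≤ ε' := (min_le_left _ _).trans (min_le_right _ _)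
    have hxε : 1 - x < ε' := by linarith
    have := H1 (y := x) (by
      rw [Real.dist_eq, abs_sub_comm, abs_of_nonneg (by linarith [hx.1.2])]; exact hxε) hx.1
    have := hx.2
    linarith

/-- All later regularity statements use only the data produced here. -/
theorem IsCriticalPoint.exists_profile {p : ℝ} (hp : 1 < p) {G ψ u : ℝ → ℝ}
    (hG : IsAdmissible G) (hψ : IsObstacle ψ) (h : IsCriticalPoint p G ψ u) :
    ∃ v μ c, CriticalProfile p G ψ u v μ c := by
  obtain ⟨v, hv, hac, hL, hu⟩ := h.mem.navier.exists_deriv hp.le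
  obtain ⟨μ, hμ, hsupp, hEL⟩ := h.eulerLagrange
  obtain ⟨δ, hδ, hδ', hsub⟩ := h.exists_margin hψ
  -- A locally finite measure concentrated in a compact interval is finite.
  have hfin : IsFiniteMeasure μ := by
    refine ⟨?_⟩
    rw [← union_compl_self (coincidenceSet ψ u)]
    refine (measure_union_le _ _).trans_lt ?_
    rw [hsupp, add_zero]
    exact (measure_mono hsub).trans_lt isCompact_Icc.measure_lt_top
  have hnull : ∀ s : Set ℝ, Disjoint s (Icc δ (1 - δ)) → μ s = 0 := fun s hs =>
    measure_mono_null (fun x hx hx' => Set.disjoint_left.1 hs hx (hsub hx')) hsupp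
  set M := μ.real univ with hM
  have hl : ∀ y ≤ δ, μ.real (Icc y 1) = M := by
    intro y hy
    refine measureReal_congr ?_
    rw [ae_eq_univ]
    refine hnull _ (Set.disjoint_left.2 fun x hx hx' => hx ⟨hy.trans hx'.1, ?_⟩)
    linarith [hx'.2]
  have hr : ∀ y, 1 - δ < y → μ.real (Icc y 1) = 0 := by
    intro y hy
    rw [measureReal_def, hnull, ENNReal.toReal_zero]
    exact Set.disjoint_left.2 fun x hx hx' => by linarith [hx.1, hx'.2]
  set g : ℝ → ℝ := fun x => deriv G (v x) with hgdef
  have hg : Continuous g := hG.continuous_deriv.comp hv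
  have hg0 : ∀ x, 0 < g x := fun x => hG.deriv_pos _
  obtain ⟨c, hc⟩ := exists_flux_one_eq_zero μ hg hg0
  have key := euler_eq_flux hp hG hv hac hL hu hEL hc
  have hvrep : ∀ x ∈ Icc (0:ℝ) 1, v x = v 0 + ∫ t in (0:ℝ)..x, deriv v t := fun x hx =>
    hac.eq_add_integral_deriv (by rwa [uIcc_of_le zero_le_one])
  -- Without contact the flux is -c∫1/g, so c = 0, then u'' = 0 and u = 0 on [0,1], contradicting u
  -- ≥ ψ where ψ > 0.
  have hMpos : 0 < M := by
    by_contra hM0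
    have hM0 : M = 0 := le_antisymm (not_lt.1 hM0) measureReal_nonneg
    have hm0 : ∀ y, μ.real (Icc y 1) = 0 := fun y =>
      le_antisymm ((measureReal_mono (subset_univ _)).trans hM0.le) measureReal_nonneg
    have hflux : ∀ x, flux μ c g x = -c * ∫ y in (0:ℝ)..x, (g y)⁻¹ := fun x => by
      simp only [flux, hm0, zero_sub, div_eq_mul_inv, intervalIntegral.integral_const_mul]
    have hI : 0 < ∫ y in (0:ℝ)..1, (g y)⁻¹ :=
      intervalIntegral.intervalIntegral_pos_of_pos
        ((hg.inv₀ fun x => (hg0 x).ne').intervalIntegrable _ _) (fun x => inv_pos.2 (hg0 x)) one_pos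
    rw [hflux 1] at hc
    have hc0 : c = 0 := by
      rcases mul_eq_zero.1 hc with h | h
      · linarith
      · linarith
    have hz : deriv v =ᵐ[volume.restrict (Ioo 0 1)] 0 := by
      filter_upwards [key] with x hx
      rw [hflux x, hc0] at hx
      have := eq_of_eulerSubst_eq hp (hg0 x) (by simp) hx
      rw [this]
      simp [Real.zero_rpow (show (p - 1)⁻¹ ≠ 0 by
        have : p - 1 ≠ 0 := by linarith
        positivity)]
    have hvc : ∀ x ∈ Icc (0:ℝ) 1, v x = v 0 := fun x hx => by
      rw [hvrep x hx, ← integral_Ioo_eq_interval _ hx.1]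
      rw [integral_congr_ae (ae_restrict_of_ae_restrict_of_subset (Ioo_subset_Ioo_right hx.2) hz)]
      simp
    have huc : ∀ x ∈ Icc (0:ℝ) 1, u x = x * v 0 := fun x hx => by
      rw [hu x hx, intervalIntegral.integral_congr (g := fun _ => v 0)]
      · simp
      · intro t ht
        rw [uIcc_of_le hx.1] at ht
        exact hvc t ⟨ht.1, ht.2.trans hx.2⟩
    have hv0 : v 0 = 0 := by
      have := huc 1 ⟨zero_le_one, le_rfl⟩
      rw [h.mem.navier.right] at this
      linarith
    obtain ⟨x, hx, hpos⟩ := hψ.pos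
    have h1 := h.mem.above x (Ioo_subset_Icc_self hx)
    rw [huc x (Ioo_subset_Icc_self hx), hv0] at h1
    linarith
  obtain ⟨hc0, hcM, k, hk, hlow⟩ := flux_lower_bound hg hg0 hc hδ hδ' hMpos hl hr
  have hWc : Continuous (flux μ c g) := continuous_flux hg hg0
  have hα : 0 ≤ 1 / (p - 1) := by
    have : 0 < p - 1 := by linarith
    positivity
  set z : ℝ → ℝ := fun x => -(flux μ c g x / p) ^ (1 / (p - 1)) / g x with hz
  have hzc : Continuous z :=
    ((hWc.div_const p).rpow_const fun _ => Or.inr hα).neg.div hg fun x => (hg0 x).ne'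
  have hvz : deriv v =ᵐ[volume.restrict (Ioo 0 1)] z := by
    filter_upwards [key, ae_restrict_mem measurableSet_Ioo] with x hx hx'
    refine eq_of_eulerSubst_eq hp (hg0 x) (le_trans ?_ (hlow x (Ioo_subset_Icc_self hx'))) hx
    exact mul_nonneg hk.le (mul_nonneg hx'.1.le (by linarith [hx'.2]))
  -- Integrating z over the whole line gives a representative that agrees with v on [0,1] and has a
  -- two-sided derivative also at 0 and 1. The flux there sees only values on [0,1], so it does not
  -- change.
  set v' : ℝ → ℝ := fun x => v 0 + ∫ t in (0:ℝ)..x, z t with hv'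
  have hvd : ∀ x, HasDerivAt v' (z x) x := fun x =>
    (hzc.integral_hasStrictDerivAt 0 x).hasDerivAt.const_add _
  have hvv : ∀ x ∈ Icc (0:ℝ) 1, v x = v' x := fun x hx => by
    show v x = v 0 + ∫ t in (0:ℝ)..x, z t
    rw [hvrep x hx, ← integral_Ioo_eq_interval _ hx.1, ← integral_Ioo_eq_interval _ hx.1]
    rw [integral_congr_ae (ae_restrict_of_ae_restrict_of_subset (Ioo_subset_Ioo_right hx.2) hvz)]
  have hflux : ∀ x ∈ Icc (0:ℝ) 1, flux μ c (fun x => deriv G (v' x)) x = flux μ c g x := by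
    intro x hx
    refine intervalIntegral.integral_congr fun y hy => ?_
    rw [uIcc_of_le hx.1] at hy
    simp only [hgdef, hvv y ⟨hy.1, hy.2.trans hx.2⟩]
  refine ⟨v', μ, c, hfin, hsupp, continuous_iff_continuousAt.2 fun x => (hvd x).continuousAt,
    fun x hx => ?_, fun x hx => ?_, h.mem.navier.right, ?_, hc0, hcM, k, hk, fun x hx => ?_⟩
  · rw [hflux x hx, ← hvv x hx]; exact hvd x
  · rw [hu x hx]
    refine intervalIntegral.integral_congr fun y hy => ?_
    rw [uIcc_of_le hx.1] at hy
    exact hvv y ⟨hy.1, hy.2.trans hx.2⟩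
  · rw [hflux 1 ⟨zero_le_one, le_rfl⟩, hc]
  · rw [hflux x hx]; exact hlow x hx

/-! ### Classical regularity and concavity. -/

/-- The second derivative of a critical point, expressed through the data of its profile. -/
noncomputable def curvature (p : ℝ) (G v : ℝ → ℝ) (μ : Measure ℝ) (c : ℝ) (x : ℝ) : ℝ :=
  -(flux μ c (fun y => deriv G (v y)) x / p) ^ (1 / (p - 1)) / deriv G (v x)

/-- A power of the flux times a function of `u'`. -/
noncomputable def fluxPower (p : ℝ) (G v : ℝ → ℝ) (μ : Measure ℝ) (c β : ℝ) (K : ℝ → ℝ)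
    (x : ℝ) : ℝ :=
  (flux μ c (fun y => deriv G (v y)) x / p) ^ β * K (v x)

namespace CriticalProfile

variable {p : ℝ} {G ψ u v : ℝ → ℝ} {μ : Measure ℝ} {c : ℝ}

/-- Both u'' and the coefficients appearing in u''' are powers of the flux times smooth functions of
u', so the estimates are proved once for this whole family. -/
theorem curvature_eq_fluxPower :
    curvature p G v μ c = fluxPower p G v μ c (1 / (p - 1)) fun s => -(deriv G s)⁻¹ := by
  ext x
  rw [curvature, fluxPower, div_eq_mul_inv, neg_mul, mul_neg]

variable (h : CriticalProfile p G ψ u v μ c) (hp : 1 < p) (hG : IsAdmissible G)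
include h

theorem hasDerivAt_curvature {x : ℝ} (hx : x ∈ Icc (0:ℝ) 1) :
    HasDerivAt v (curvature p G v μ c x) x := h.hasDerivAt x hx

theorem flux_nonneg {x : ℝ} (hx : x ∈ Icc (0:ℝ) 1) :
    0 ≤ flux μ c (fun x => deriv G (v x)) x := by
  obtain ⟨k, hk, hlow⟩ := h.lower
  exact le_trans (mul_nonneg hk.le (mul_nonneg hx.1 (by linarith [hx.2]))) (hlow x hx)

theorem flux_pos {x : ℝ} (hx : x ∈ Ioo (0:ℝ) 1) :
    0 < flux μ c (fun x => deriv G (v x)) x := by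
  obtain ⟨k, hk, hlow⟩ := h.lower
  exact lt_of_lt_of_le (mul_pos hk (mul_pos hx.1 (by linarith [hx.2])))
    (hlow x (Ioo_subset_Icc_self hx))

include hG

theorem continuous_weight : Continuous fun x => deriv G (v x) := hG.continuous_deriv.comp h.cont

theorem continuous_flux : Continuous (flux μ c fun x => deriv G (v x)) :=
  have := h.finite
  ObstacleProblem.continuous_flux (h.continuous_weight hG) fun _ => hG.deriv_pos _

theorem continuous_fluxPower {β : ℝ} (hβ : 0 ≤ β) {K : ℝ → ℝ} (hK : Continuous K) :
    Continuous (fluxPower p G v μ c β K) :=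
  (((h.continuous_flux hG).div_const p).rpow_const fun _ => Or.inr hβ).mul (hK.comp h.cont)

omit hG in
theorem absolutelyContinuous_v (hcurv : Continuous (curvature p G v μ c)) :
    AbsolutelyContinuousOnInterval v 0 1 :=
  .of_hasDerivAt (fun _ hx => h.hasDerivAt_curvature (by rwa [uIcc_of_le zero_le_one] at hx))
    hcurv.continuousOn

include hp

theorem continuous_curvature : Continuous (curvature p G v μ c) := by
  rw [curvature_eq_fluxPower]
  refine h.continuous_fluxPower hG ?_ (hG.continuous_deriv.inv₀ fun s => (hG.deriv_pos s).ne').neg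
  have : 0 < p - 1 := by linarith
  positivity

theorem curvature_neg {x : ℝ} (hx : x ∈ Ioo (0:ℝ) 1) : curvature p G v μ c x < 0 := by
  rw [curvature, neg_div, neg_neg_iff_pos]
  exact div_pos (Real.rpow_pos_of_pos (div_pos (h.flux_pos hx) (by linarith)) _) (hG.deriv_pos _)

omit hG h in
theorem curvature_zero : curvature p G v μ c 0 = 0 := by
  have : (p - 1)⁻¹ ≠ 0 := by
    have : p - 1 ≠ 0 := by linarith
    positivity
  rw [curvature, flux_zero]
  simp [Real.zero_rpow this]

omit hG in
theorem curvature_one : curvature p G v μ c 1 = 0 := by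
  have : (p - 1)⁻¹ ≠ 0 := by
    have : p - 1 ≠ 0 := by linarith
    positivity
  rw [curvature, h.flux_one]
  simp [Real.zero_rpow this]

omit hp hG in
theorem hasDerivWithinAt_u {x : ℝ} (hx : x ∈ Icc (0:ℝ) 1) :
    HasDerivWithinAt u (v x) (Icc 0 1) x :=
  (h.cont.integral_hasStrictDerivAt 0 x).hasDerivAt.hasDerivWithinAt.congr
    (fun y hy => h.primitive y hy) (h.primitive x hx)

omit hp hG in
theorem hasDerivAt_u {x : ℝ} (hx : x ∈ Ioo (0:ℝ) 1) : HasDerivAt u (v x) x :=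
  hasDerivAt_of_eq_primitive h.cont h.primitive hx

omit hp hG in
theorem derivWithin_u {x : ℝ} (hx : x ∈ Icc (0:ℝ) 1) : derivWithin u (Icc 0 1) x = v x :=
  (h.hasDerivWithinAt_u hx).derivWithin (uniqueDiffOn_Icc zero_lt_one x hx)

omit hp hG in
theorem derivWithin_v {x : ℝ} (hx : x ∈ Icc (0:ℝ) 1) :
    derivWithin v (Icc 0 1) x = curvature p G v μ c x :=
  (h.hasDerivAt_curvature hx).hasDerivWithinAt.derivWithin (uniqueDiffOn_Icc zero_lt_one x hx)

theorem contDiffOn_two : ContDiffOn ℝ 2 u (Icc 0 1) := by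
  have hu : UniqueDiffOn ℝ (Icc (0:ℝ) 1) := uniqueDiffOn_Icc zero_lt_one
  have hv : ContDiffOn ℝ 1 v (Icc 0 1) := by
    rw [show (1 : WithTop ℕ∞) = 0 + 1 by rfl, contDiffOn_succ_iff_derivWithin hu]
    refine ⟨fun x hx => (h.hasDerivAt_curvature hx).differentiableAt.differentiableWithinAt,
      by simp, ?_⟩
    rw [contDiffOn_zero]
    exact (h.continuous_curvature hp hG).continuousOn.congr fun x hx => h.derivWithin_v hx
  rw [show (2 : WithTop ℕ∞) = 1 + 1 by rfl, contDiffOn_succ_iff_derivWithin hu]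
  refine ⟨fun x hx => (h.hasDerivWithinAt_u hx).differentiableWithinAt, by simp, ?_⟩
  exact hv.congr fun x hx => h.derivWithin_u hx

omit hp hG in
theorem iteratedDerivWithin_two {x : ℝ} (hx : x ∈ Icc (0:ℝ) 1) :
    iteratedDerivWithin 2 u (Icc 0 1) x = curvature p G v μ c x := by
  rw [show (2:ℕ) = 1 + 1 by rfl, iteratedDerivWithin_succ, ← h.derivWithin_v hx]
  refine derivWithin_congr (fun y hy => ?_) ?_
  · rw [iteratedDerivWithin_one, h.derivWithin_u hy]
  · rw [iteratedDerivWithin_one, h.derivWithin_u hx]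

omit hp hG in
theorem deriv_deriv_u {x : ℝ} (hx : x ∈ Ioo (0:ℝ) 1) :
    deriv (deriv u) x = curvature p G v μ c x := by
  have : deriv u =ᶠ[𝓝 x] v := by
    filter_upwards [isOpen_Ioo.mem_nhds hx] with y hy
    exact (h.hasDerivAt_u hy).deriv
  rw [this.deriv_eq, (h.hasDerivAt_curvature (Ioo_subset_Icc_self hx)).deriv]

theorem strictConcaveOn : StrictConcaveOn ℝ (Icc 0 1) u := by
  refine strictConcaveOn_of_deriv2_neg (convex_Icc _ _)
    (fun x hx => (h.hasDerivWithinAt_u hx).continuousWithinAt) fun x hx => ?_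
  rw [interior_Icc] at hx
  have : deriv^[2] u x = deriv (deriv u) x := rfl
  rw [this, h.deriv_deriv_u hx]
  exact h.curvature_neg hp hG hx

/-! ### Powers of the flux and third-order Sobolev regularity. -/

omit hp in
theorem absolutelyContinuous_flux :
    AbsolutelyContinuousOnInterval (flux μ c fun x => deriv G (v x)) 0 1 :=
  have := h.finite
  ObstacleProblem.absolutelyContinuous_flux (h.continuous_weight hG) fun _ => hG.deriv_pos _

theorem absolutelyContinuous_fluxPower_Ioo (β : ℝ) {K : ℝ → ℝ} (hK : ContDiff ℝ 1 K)
    {a b : ℝ} (ha : 0 < a) (hab : a ≤ b) (hb : b < 1) :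
    AbsolutelyContinuousOnInterval (fluxPower p G v μ c β K) a b := by
  have hsub : uIcc a b ⊆ uIcc (0:ℝ) 1 := by
    rw [uIcc_of_le hab, uIcc_of_le zero_le_one]; exact Icc_subset_Icc ha.le hb.le
  have hsub' : uIcc a b ⊆ Ioo (0:ℝ) 1 := by
    rw [uIcc_of_le hab]; exact fun x hx => ⟨ha.trans_le hx.1, hx.2.trans_lt hb⟩
  have h1 := ((h.absolutelyContinuous_v (h.continuous_curvature hp hG)).mono hsub).contDiff_comp hK
  have hW := (h.absolutelyContinuous_flux hG).mono hsub
  have hWp := hW.const_mul p⁻¹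
  have hcW : ContinuousOn (fun x => p⁻¹ * flux μ c (fun x => deriv G (v x)) x) (uIcc a b) :=
    hWp.continuousOn
  obtain ⟨x₁, hx₁, hmin⟩ := isCompact_uIcc.exists_isMinOn nonempty_uIcc hcW
  obtain ⟨x₂, hx₂, hmax⟩ := isCompact_uIcc.exists_isMaxOn nonempty_uIcc hcW
  have hpos : 0 < p⁻¹ * flux μ c (fun x => deriv G (v x)) x₁ :=
    mul_pos (inv_pos.2 (by linarith)) (h.flux_pos (hsub' hx₁))
  -- Away from the endpoints the flux stays in a compact interval of positive numbers, on which t ↦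
  -- t^β is C¹ for every real β.
  have h2 := hWp.contDiffOn_comp (H := fun t => t ^ β) (c := _) (d := _)
    (fun t ht => (Real.contDiffAt_rpow_const_of_ne (hpos.trans_le ht.1).ne').contDiffWithinAt)
    fun x hx => ⟨hmin hx, hmax hx⟩
  refine (h2.fun_mul h1).congr_eqOn fun x _ => ?_
  simp only [fluxPower, div_eq_inv_mul]

theorem ae_hasDerivAt_fluxPower (β : ℝ) {K : ℝ → ℝ} (hK : ContDiff ℝ 1 K) :
    ∀ᵐ x ∂(volume.restrict (Ioo (0:ℝ) 1)), HasDerivAt (fluxPower p G v μ c β K)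
      (β * (flux μ c (fun y => deriv G (v y)) x / p) ^ (β - 1) *
          ((μ.real (Icc x 1) - c) / deriv G (v x) / p) * K (v x) +
        (flux μ c (fun y => deriv G (v y)) x / p) ^ β *
          (deriv K (v x) * curvature p G v μ c x)) x := by
  have := h.finite
  filter_upwards [ae_hasDerivAt_flux (μ := μ) (c := c) (h.continuous_weight hG)
    fun _ => hG.deriv_pos _, ae_restrict_mem measurableSet_Ioo] with x hx hx'
  have hWp : 0 < flux μ c (fun y => deriv G (v y)) x / p :=
    div_pos (h.flux_pos hx') (by linarith)
  have h1 := (hx.div_const p).rpow_const (p := β) (Or.inl hWp.ne')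
  have h2 : HasDerivAt (fun x => K (v x)) (deriv K (v x) * curvature p G v μ c x) x :=
    ((hK.differentiable (by simp)) _).hasDerivAt.comp x
      (h.hasDerivAt_curvature (Ioo_subset_Icc_self hx'))
  refine (h1.mul h2).congr_deriv ?_
  ring

/-- The factor β is kept in the bound: at β = 0 it removes the power -1 of the flux, which could not
be controlled otherwise. -/
theorem exists_bound_deriv_fluxPower {β : ℝ} (hβ : 0 ≤ β) {K : ℝ → ℝ} (hK : ContDiff ℝ 1 K) :
    ∃ C, 0 ≤ C ∧ ∀ᵐ x ∂(volume.restrict (Ioo (0:ℝ) 1)), ‖deriv (fluxPower p G v μ c β K) x‖ ≤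
      β * (flux μ c (fun y => deriv G (v y)) x / p) ^ (β - 1) * C + C := by
  have := h.finite
  have hcv := h.continuous_curvature hp hG
  have hc1 : Continuous fun x => (deriv G (v x))⁻¹ / p * K (v x) :=
    (((h.continuous_weight hG).inv₀ fun x => (hG.deriv_pos _).ne').div_const p).mul
      (hK.continuous.comp h.cont)
  have hc2 : Continuous fun x => (flux μ c (fun y => deriv G (v y)) x / p) ^ β *
      (deriv K (v x) * curvature p G v μ c x) :=
    (((h.continuous_flux hG).div_const p).rpow_const fun _ => Or.inr hβ).mul
      (((hK.continuous_deriv (by simp)).comp h.cont).mul hcv)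
  obtain ⟨C₁, hC₁⟩ := (isCompact_Icc (a := (0:ℝ)) (b := 1)).exists_bound_of_continuousOn
    hc1.continuousOn
  obtain ⟨C₂, hC₂⟩ := (isCompact_Icc (a := (0:ℝ)) (b := 1)).exists_bound_of_continuousOn
    hc2.continuousOn
  have hC₁0 := (norm_nonneg _).trans (hC₁ 0 ⟨le_rfl, zero_le_one⟩)
  have hC₂0 := (norm_nonneg _).trans (hC₂ 0 ⟨le_rfl, zero_le_one⟩)
  have hc0 := h.c_pos
  have hM0 : 0 ≤ μ.real univ := measureReal_nonneg
  refine ⟨(μ.real univ + c) * C₁ + C₂, by positivity, ?_⟩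
  filter_upwards [h.ae_hasDerivAt_fluxPower hp hG β hK, ae_restrict_mem measurableSet_Ioo]
    with x hx hx'
  have hI := Ioo_subset_Icc_self hx'
  have hWp : 0 < flux μ c (fun y => deriv G (v y)) x / p :=
    div_pos (h.flux_pos hx') (by linarith)
  have hr : 0 ≤ β * (flux μ c (fun y => deriv G (v y)) x / p) ^ (β - 1) :=
    mul_nonneg hβ (Real.rpow_nonneg hWp.le _)
  have hm : |μ.real (Icc x 1) - c| ≤ μ.real univ + c := by
    have h1 : 0 ≤ μ.real (Icc x 1) := measureReal_nonneg
    have h2 : μ.real (Icc x 1) ≤ μ.real univ := measureReal_mono (subset_univ _)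
    rw [abs_le]; constructor <;> linarith
  rw [hx.deriv]
  refine (norm_add_le _ _).trans (add_le_add ?_ ((hC₂ x hI).trans ?_))
  · have e : β * (flux μ c (fun y => deriv G (v y)) x / p) ^ (β - 1) *
        ((μ.real (Icc x 1) - c) / deriv G (v x) / p) * K (v x) =
        β * (flux μ c (fun y => deriv G (v y)) x / p) ^ (β - 1) *
        ((μ.real (Icc x 1) - c) * ((deriv G (v x))⁻¹ / p * K (v x))) := by
      field_simp
    rw [e, norm_mul, Real.norm_of_nonneg hr, norm_mul, Real.norm_eq_abs (_ - _)]
    refine mul_le_mul_of_nonneg_left ?_ hr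
    have := mul_le_mul hm (hC₁ x hI) (norm_nonneg _) (by linarith)
    linarith
  · nlinarith [mul_nonneg (add_nonneg hM0 hc0.le) hC₁0]

omit hG in
-- A nonpositive power reverses the lower bound on the flux, and x(1-x) is at least half the
-- distance to the nearer endpoint.
theorem exists_rpow_flux_le {γ : ℝ} (hγ : γ ≤ 0) : ∃ C, ∀ x ∈ Ioo (0:ℝ) 1,
    (flux μ c (fun y => deriv G (v y)) x / p) ^ γ ≤ C * (x ^ γ + (1 - x) ^ γ) := by
  obtain ⟨k, hk, hlow⟩ := h.lower
  refine ⟨(k / (2 * p)) ^ γ, fun x hx => ?_⟩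
  have hp0 : 0 < p := by linarith
  have hk' : 0 < k / (2 * p) := by positivity
  have hx1 : 0 < 1 - x := by linarith [hx.2]
  have base : k / p * (x * (1 - x)) ≤ flux μ c (fun y => deriv G (v y)) x / p := by
    have := hlow x (Ioo_subset_Icc_self hx)
    calc _ = k * (x * (1 - x)) / p := by ring
      _ ≤ _ := by gcongr
  have e1 := Real.rpow_nonneg hx.1.le γ
  have e2 := Real.rpow_nonneg hx1.le γ
  have e3 := Real.rpow_nonneg hk'.le γ
  have key : ∀ y, 0 < y → k / (2 * p) * y ≤ k / p * (x * (1 - x)) →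
      (flux μ c (fun y => deriv G (v y)) x / p) ^ γ ≤ (k / (2 * p)) ^ γ * y ^ γ := by
    intro y hy hle
    rw [← Real.mul_rpow hk'.le hy.le]
    exact Real.rpow_le_rpow_of_nonpos (by positivity) (hle.trans base) hγ
  rcases le_total x (1 / 2) with hh | hh
  · refine (key x hx.1 ?_).trans (mul_le_mul_of_nonneg_left (by linarith) e3)
    calc k / (2 * p) * x = k / p * (x * (1 / 2)) := by field_simp
      _ ≤ _ := by gcongr; exact hx.1.le; linarith
  · refine (key (1 - x) hx1 ?_).trans (mul_le_mul_of_nonneg_left (by linarith) e3)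
    calc k / (2 * p) * (1 - x) = k / p * ((1 / 2) * (1 - x)) := by field_simp
      _ ≤ _ := by gcongr

theorem integrableOn_rpow_flux {γ : ℝ} (hγ : -1 < γ) :
    IntegrableOn (fun x => (flux μ c (fun y => deriv G (v y)) x / p) ^ γ) (Ioo 0 1) := by
  have hc := (h.continuous_flux hG).div_const p
  rcases le_total 0 γ with h0 | h0
  · exact (hc.rpow_const fun _ => Or.inr h0).continuousOn.integrableOn_Icc.mono_set
      Ioo_subset_Icc_self
  obtain ⟨C, hC⟩ := h.exists_rpow_flux_le hp h0
  have i1 : IntegrableOn (fun x : ℝ => x ^ γ) (Ioo 0 1) :=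
    (intervalIntegrable_iff_integrableOn_Ioo_of_le zero_le_one).1
      (intervalIntegral.intervalIntegrable_rpow' hγ)
  have i2 : IntegrableOn (fun x : ℝ => (1 - x) ^ γ) (Ioo 0 1) := by
    have := (intervalIntegral.intervalIntegrable_rpow' (a := 1) (b := 0) hγ).comp_sub_left 1
    simp only [sub_self, sub_zero] at this
    exact (intervalIntegrable_iff_integrableOn_Ioo_of_le zero_le_one).1 this
  refine Integrable.mono' ((i1.add i2).const_mul C) ?_ ?_
  · exact (hc.measurable.pow_const γ).aestronglyMeasurable
  · filter_upwards [ae_restrict_mem measurableSet_Ioo] with x hx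
    rw [Real.norm_of_nonneg (Real.rpow_nonneg
      (div_nonneg (h.flux_nonneg (Ioo_subset_Icc_self hx)) (by linarith)) _)]
    exact hC x hx

theorem memLp_deriv_fluxPower {β q : ℝ} (hβ : 0 < β) (hq : 1 ≤ q) (hq' : -1 < (β - 1) * q)
    {K : ℝ → ℝ} (hK : ContDiff ℝ 1 K) :
    MemLp (deriv (fluxPower p G v μ c β K)) (ENNReal.ofReal q) (volume.restrict (Ioo 0 1)) := by
  obtain ⟨C, hC, hb⟩ := h.exists_bound_deriv_fluxPower hp hG hβ.le hK
  have hq0 : 0 < q := by linarith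
  have i1 : MemLp (fun x => (flux μ c (fun y => deriv G (v y)) x / p) ^ (β - 1))
      (ENNReal.ofReal q) (volume.restrict (Ioo 0 1)) := by
    have hm : AEStronglyMeasurable (fun x => (flux μ c (fun y => deriv G (v y)) x / p) ^ (β - 1))
        (volume.restrict (Ioo 0 1)) :=
      (((h.continuous_flux hG).div_const p).measurable.pow_const _).aestronglyMeasurable
    rw [← integrable_norm_rpow_iff hm (by simpa using hq0) (by simp),
      ENNReal.toReal_ofReal hq0.le]
    refine (h.integrableOn_rpow_flux hp hG hq').congr ?_
    filter_upwards [ae_restrict_mem measurableSet_Ioo] with x hx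
    have hW : 0 ≤ flux μ c (fun y => deriv G (v y)) x / p :=
      div_nonneg (h.flux_nonneg (Ioo_subset_Icc_self hx)) (by linarith)
    rw [Real.norm_of_nonneg (Real.rpow_nonneg hW _), ← Real.rpow_mul hW]
  have i2 := ((i1.const_mul β).mul_const C).add
    (memLp_const (p := ENNReal.ofReal q) (μ := volume.restrict (Ioo (0:ℝ) 1)) C)
  refine i2.mono' (measurable_deriv _).aestronglyMeasurable ?_
  exact hb

theorem exists_bound_deriv_fluxPower_of_one_le {β : ℝ} (hβ : β = 0 ∨ 1 ≤ β) {K : ℝ → ℝ}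
    (hK : ContDiff ℝ 1 K) :
    ∃ C, ∀ᵐ x ∂(volume.restrict (Ioo (0:ℝ) 1)), ‖deriv (fluxPower p G v μ c β K) x‖ ≤ C := by
  have hβ0 : 0 ≤ β := by rcases hβ with rfl | h <;> linarith
  obtain ⟨C, hC, hb⟩ := h.exists_bound_deriv_fluxPower hp hG hβ0 hK
  rcases hβ with rfl | hβ
  · refine ⟨C, ?_⟩
    filter_upwards [hb] with x hx
    simpa using hx
  · have hc : Continuous fun x => (flux μ c (fun y => deriv G (v y)) x / p) ^ (β - 1) :=
      ((h.continuous_flux hG).div_const p).rpow_const fun _ => Or.inr (by linarith)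
    obtain ⟨C', hC'⟩ := (isCompact_Icc (a := (0:ℝ)) (b := 1)).exists_bound_of_continuousOn
      hc.continuousOn
    refine ⟨β * C' * C + C, ?_⟩
    filter_upwards [hb, ae_restrict_mem measurableSet_Ioo] with x hx hx'
    refine hx.trans ?_
    have := (le_abs_self _).trans (hC' x (Ioo_subset_Icc_self hx'))
    gcongr

/-- For 0 < β < 1 the power is not Lipschitz at the zeros 0 and 1 of the flux, so composition is not
enough there; continuity and an integrable derivative bridge the endpoints. -/
theorem absolutelyContinuous_fluxPower {β : ℝ} (hβ : 0 ≤ β) {K : ℝ → ℝ} (hK : ContDiff ℝ 1 K) :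
    AbsolutelyContinuousOnInterval (fluxPower p G v μ c β K) 0 1 := by
  refine .of_forall_Ioo zero_lt_one
    (fun a b h1 h2 h3 => h.absolutelyContinuous_fluxPower_Ioo hp hG β hK h1 h2 h3)
    (h.continuous_fluxPower hG hβ hK.continuous).continuousOn ?_
  rw [intervalIntegrable_iff_integrableOn_Ioo_of_le zero_le_one]
  rcases hβ.eq_or_lt with rfl | hβ
  · obtain ⟨C, hC⟩ := h.exists_bound_deriv_fluxPower_of_one_le hp hG (Or.inl rfl) hK
    exact Integrable.of_bound (measurable_deriv _).aestronglyMeasurable C hC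
  · exact (h.memLp_deriv_fluxPower hp hG hβ le_rfl (by linarith) hK).integrable (by simp)

omit h hp in
theorem contDiff_neg_inv_deriv : ContDiff ℝ ∞ fun s => -(deriv G s)⁻¹ :=
  (hG.contDiff_deriv.inv fun s => (hG.deriv_pos s).ne').neg

theorem absolutelyContinuous_curvature :
    AbsolutelyContinuousOnInterval (curvature p G v μ c) 0 1 := by
  rw [curvature_eq_fluxPower]
  refine h.absolutelyContinuous_fluxPower hp hG ?_
    ((contDiff_neg_inv_deriv hG).of_le (by simp))
  have : 0 < p - 1 := by linarith
  positivity

omit hp hG in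
theorem hasWeakDeriv_u : HasWeakDeriv u v := hasWeakDeriv_of_eq_primitive h.cont h.primitive

theorem hasWeakDeriv_v : HasWeakDeriv v (curvature p G v μ c) :=
  .of_hasDerivAt (fun _ hx => h.hasDerivAt_curvature (Ioo_subset_Icc_self hx))
    (h.continuous_curvature hp hG).continuousOn

theorem hasWeakDeriv_curvature :
    HasWeakDeriv (curvature p G v μ c) (deriv (curvature p G v μ c)) :=
  .of_absolutelyContinuous_Icc (h.absolutelyContinuous_curvature hp hG)

theorem weakDeriv_three :
    weakDeriv (weakDeriv (weakDeriv u)) =ᵐ[volume.restrict (Ioo 0 1)]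
      deriv (curvature p G v μ c) := by
  have h1 := h.hasWeakDeriv_u.weakDeriv_ae_eq
  have h2 := ((h.hasWeakDeriv_v hp hG).congr h1.symm (ae_eq_refl _)).weakDeriv_ae_eq
  exact ((h.hasWeakDeriv_curvature hp hG).congr h2.symm (ae_eq_refl _)).weakDeriv_ae_eq

theorem memSobolev_three {q : ℝ≥0∞}
    (hL : MemLp (deriv (curvature p G v μ c)) q (volume.restrict (Ioo 0 1))) :
    MemSobolev 3 q u := by
  have hc : ContinuousOn u (Icc 0 1) := fun x hx => (h.hasDerivWithinAt_u hx).continuousWithinAt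
  exact ⟨memLp_of_continuous hc, v, h.hasWeakDeriv_u, memLp_of_continuous h.cont.continuousOn, _,
    h.hasWeakDeriv_v hp hG, memLp_of_continuous (h.continuous_curvature hp hG).continuousOn, _,
    h.hasWeakDeriv_curvature hp hG, hL⟩

theorem memSobolev_three_top (hp2 : p ≤ 2) : MemSobolev 3 ⊤ u := by
  refine h.memSobolev_three hp hG ?_
  rw [curvature_eq_fluxPower]
  obtain ⟨C, hC⟩ := h.exists_bound_deriv_fluxPower_of_one_le hp hG (β := 1 / (p - 1))
    (Or.inr (by rw [le_div_iff₀ (by linarith)]; linarith))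
    ((contDiff_neg_inv_deriv hG).of_le (by simp))
  exact MemLp.of_bound (measurable_deriv _).aestronglyMeasurable C hC

theorem memSobolev_three_of_lt (hp2 : 2 < p) {q : ℝ} (hq : 1 ≤ q)
    (hq' : q < (p - 1) / (p - 2)) : MemSobolev 3 (ENNReal.ofReal q) u := by
  refine h.memSobolev_three hp hG ?_
  rw [curvature_eq_fluxPower]
  have hp1 : 0 < p - 1 := by linarith
  refine h.memLp_deriv_fluxPower hp hG (by positivity) hq ?_
    ((contDiff_neg_inv_deriv hG).of_le (by simp))
  rw [lt_div_iff₀ (by linarith)] at hq'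
  -- The exponent of the flux in |u'''|^q; it exceeds -1 exactly when q < (p-1)/(p-2).
  have : (1 / (p - 1) - 1) * q = -(q * (p - 2)) / (p - 1) := by field_simp; ring
  rw [this, lt_div_iff₀ hp1]
  linarith

end CriticalProfile

/-! ### Bounded variation of the third derivative. -/

/-- An absolutely continuous function times the tail of a finite measure, plus an absolutely
continuous function, has bounded variation. -/
theorem memBV_of_ae_eq (μ : Measure ℝ) [IsFiniteMeasure μ] {f A E : ℝ → ℝ}
    (hA : AbsolutelyContinuousOnInterval A 0 1) (hE : AbsolutelyContinuousOnInterval E 0 1)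
    (hf : f =ᵐ[volume.restrict (Ioo 0 1)] fun x => A x * μ.real (Icc x 1) + E x) : MemBV f := by
  have hmi : IntervalIntegrable (fun x => μ.real (Icc x 1)) volume 0 1 :=
    (antitone_tail μ).intervalIntegrable
  have hAm : IntervalIntegrable (fun x => A x * μ.real (Icc x 1)) volume 0 1 :=
    hmi.continuousOn_mul hA.continuousOn
  have hEi : IntervalIntegrable E volume 0 1 := hE.continuousOn.intervalIntegrable
  obtain ⟨a, ha⟩ := hA.exists_bound
  have ha0 : 0 ≤ a := (norm_nonneg _).trans (ha 0 left_mem_uIcc)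
  have hA' := hA.intervalIntegrable_deriv
  have hE' := hE.intervalIntegrable_deriv
  set M := μ.real univ with hM
  have hM0 : 0 ≤ M := measureReal_nonneg
  constructor
  · exact ((intervalIntegrable_iff_integrableOn_Ioo_of_le zero_le_one).1 (hAm.add hEi)).congr hf.symm
  refine ⟨a * M + M * (∫ x in (0:ℝ)..1, |deriv A x|) + ∫ x in (0:ℝ)..1, |deriv E x|,
    fun φ hφ hφ1 => ?_⟩
  have hφac := hφ.absolutelyContinuous 0 1
  have hφ0 : φ 0 = 0 := hφ.zero_of_notMem (by simp)
  have hφ1' : φ 1 = 0 := hφ.zero_of_notMem (by simp)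
  have hdφ : Continuous (deriv φ) := hφ.continuous_deriv
  have hAφ := hA.fun_mul hφac
  have e0 : ∫ x in Ioo (0:ℝ) 1, f x * deriv φ x =
      (∫ x in (0:ℝ)..1, A x * μ.real (Icc x 1) * deriv φ x) + ∫ x in (0:ℝ)..1, E x * deriv φ x := by
    rw [← intervalIntegral.integral_add (hAm.mul_continuousOn hdφ.continuousOn)
      (hEi.mul_continuousOn hdφ.continuousOn), ← integral_Ioo_eq_interval _ zero_le_one]
    refine integral_congr_ae ?_
    filter_upwards [hf] with x hx
    rw [hx]; ring
  have e1 : ∫ x in (0:ℝ)..1, E x * deriv φ x = -∫ x in (0:ℝ)..1, deriv E x * φ x := by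
    rw [hE.integral_mul_deriv_eq_deriv_mul hφac, hφ0, hφ1']; ring
  have i1 : IntervalIntegrable (fun x => deriv (fun x => A x * φ x) x * μ.real (Icc x 1))
      volume 0 1 := by
    have hd := hAφ.intervalIntegrable_deriv
    rw [intervalIntegrable_iff] at hd ⊢
    refine hd.mul_bdd (c := M) (antitone_tail μ).measurable.aestronglyMeasurable
      (Eventually.of_forall fun x => ?_)
    rw [Real.norm_of_nonneg measureReal_nonneg]
    exact measureReal_mono (subset_univ _)
  have i2 : IntervalIntegrable (fun x => deriv A x * (φ x * μ.real (Icc x 1))) volume 0 1 := by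
    rw [intervalIntegrable_iff] at hA' ⊢
    refine hA'.mul_bdd (c := M)
      (hφ.continuous.measurable.mul (antitone_tail μ).measurable).aestronglyMeasurable
      (Eventually.of_forall fun x => ?_)
    rw [norm_mul, Real.norm_of_nonneg measureReal_nonneg]
    exact (mul_le_of_le_one_left measureReal_nonneg (hφ1 x)).trans
      (measureReal_mono (subset_univ _))
  -- Amφ' = (Aφ)'m - A'φm, and the first term integrates to ∫ Aφ dμ. No derivative is left on φ, so
  -- |φ| ≤ 1 suffices for the bounds.
  have e2 : ∫ x in (0:ℝ)..1, A x * μ.real (Icc x 1) * deriv φ x =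
      (∫ x in Icc (0:ℝ) 1, A x * φ x ∂μ) -
        ∫ x in (0:ℝ)..1, deriv A x * (φ x * μ.real (Icc x 1)) := by
    rw [setIntegral_eq_integral_deriv_mul_tail μ hAφ (by rw [hφ0, mul_zero]),
      integral_Ioo_eq_interval _ zero_le_one, ← intervalIntegral.integral_sub i1 i2,
      ← integral_Ioo_eq_interval _ zero_le_one, ← integral_Ioo_eq_interval _ zero_le_one]
    refine integral_congr_ae ?_
    rw [EventuallyEq, ae_restrict_iff' measurableSet_Ioo]
    filter_upwards [hA.ae_differentiableAt] with x hx hx'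
    have hx2 := (hx (by rw [uIcc_of_le zero_le_one]; exact Ioo_subset_Icc_self hx')).hasDerivAt
    have hd : HasDerivAt (fun x => A x * φ x) (deriv A x * φ x + A x * deriv φ x) x :=
      hx2.mul (hφ.hasDerivAt x)
    rw [hd.deriv]; ring
  have b1 : ∫ x in Icc (0:ℝ) 1, A x * φ x ∂μ ≤ a * M := by
    refine (Real.le_norm_self _).trans ((norm_setIntegral_le_of_norm_le_const (C := a)
      (measure_lt_top _ _) fun x hx => ?_).trans ?_)
    · rw [norm_mul]
      exact (mul_le_of_le_one_right (norm_nonneg _) (hφ1 x)).trans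
        (ha x (by rwa [uIcc_of_le zero_le_one]))
    · exact mul_le_mul_of_nonneg_left (measureReal_mono (subset_univ _)) ha0
  have b2 : -∫ x in (0:ℝ)..1, deriv A x * (φ x * μ.real (Icc x 1)) ≤
      M * ∫ x in (0:ℝ)..1, |deriv A x| := by
    rw [← intervalIntegral.integral_neg, ← intervalIntegral.integral_const_mul]
    refine intervalIntegral.integral_mono_on zero_le_one i2.neg (hA'.abs.const_mul M)
      fun x _ => (neg_le_abs _).trans ?_
    rw [abs_mul, abs_mul, abs_of_nonneg (measureReal_nonneg : 0 ≤ μ.real (Icc x 1)), mul_comm]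
    refine mul_le_mul_of_nonneg_right ?_ (abs_nonneg _)
    exact (mul_le_of_le_one_left measureReal_nonneg (hφ1 x)).trans
      (measureReal_mono (subset_univ _))
  have b3 : -∫ x in (0:ℝ)..1, deriv E x * φ x ≤ ∫ x in (0:ℝ)..1, |deriv E x| := by
    rw [← intervalIntegral.integral_neg]
    refine intervalIntegral.integral_mono_on zero_le_one
      (hE'.mul_continuousOn hφ.continuous.continuousOn).neg hE'.abs fun x _ => (neg_le_abs _).trans ?_
    rw [abs_mul]
    exact mul_le_of_le_one_right (abs_nonneg _) (hφ1 x)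
  rw [e0, e1, e2]
  linarith

namespace CriticalProfile

variable {p : ℝ} {G ψ u v : ℝ → ℝ} {μ : Measure ℝ} {c : ℝ}

theorem memBV (h : CriticalProfile p G ψ u v μ c) (hp : 1 < p) (hG : IsAdmissible G)
    (hp2 : p ≤ 2) : MemBV (weakDeriv (weakDeriv (weakDeriv u))) := by
  have := h.finite
  have hp1 : 0 < p - 1 := by linarith
  set α := 1 / (p - 1) with hα
  have hα1 : 1 ≤ α := by rw [hα, le_div_iff₀ hp1]; linarith
  set K : ℝ → ℝ := fun s => -(deriv G s)⁻¹ with hK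
  have hKs : ContDiff ℝ ∞ K := contDiff_neg_inv_deriv hG
  have hK' : ContDiff ℝ 1 (deriv K) := (contDiff_infty_iff_deriv.1 hKs).2.of_le (by simp)
  have hK1 : ContDiff ℝ 1 K := hKs.of_le (by simp)
  -- The product rule for (W/p)^α·K(u') with K = -1/G' yields u''' = Am + E. Here A carries the
  -- power α - 1, nonnegative because p ≤ 2 (and zero for p = 2), and E carries the power 2α
  -- together with -cA.
  have hA := h.absolutelyContinuous_fluxPower hp hG (β := α - 1) (by linarith)
    (K := fun s => -(α / p) * (K s * K s)) (contDiff_const.mul (hK1.mul hK1))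
  have hB := h.absolutelyContinuous_fluxPower hp hG (β := 2 * α) (by linarith)
    (K := fun s => deriv K s * K s) (hK'.mul hK1)
  refine memBV_of_ae_eq μ hA (hB.fun_add (hA.const_mul (-c))) ?_
  filter_upwards [h.weakDeriv_three hp hG, h.ae_hasDerivAt_fluxPower hp hG α hK1,
    ae_restrict_mem measurableSet_Ioo] with x h1 h2 hx
  have hWp : 0 < flux μ c (fun y => deriv G (v y)) x / p :=
    div_pos (h.flux_pos hx) (by linarith)
  rw [h1, curvature_eq_fluxPower, h2.deriv, curvature_eq_fluxPower]
  simp only [fluxPower, ← hα]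
  have e : 2 * α = α + α := by ring
  rw [e, Real.rpow_add hWp]
  have : (deriv G (v x))⁻¹ = -K (v x) := by simp [hK]
  rw [div_eq_mul_inv _ (deriv G (v x)), this]
  ring

/-! ### Sharpness of the Sobolev exponent. -/

theorem not_memSobolev_three (h : CriticalProfile p G ψ u v μ c) (hp : 2 < p)
    (hG : IsAdmissible G) : ¬ MemSobolev 3 (ENNReal.ofReal ((p - 1) / (p - 2))) u := by
  have hp' : 1 < p := by linarith
  have hp1 : 0 < p - 1 := by linarith
  have hp2 : 0 < p - 2 := by linarith
  rintro ⟨-, u₁, hu₁, -, u₂, hu₂, -, u₃, hu₃, hL⟩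
  have e1 := hu₁.ae_eq h.hasWeakDeriv_u
  have e2 := (hu₂.congr e1 (ae_eq_refl _)).ae_eq (h.hasWeakDeriv_v hp' hG)
  have e3 := (hu₃.congr e2 (ae_eq_refl _)).ae_eq (h.hasWeakDeriv_curvature hp' hG)
  change MemLp u₃ _ _ at hL
  rw [memLp_congr_ae e3] at hL
  set U := curvature p G v μ c with hU
  set q := (p - 1) / (p - 2) with hq
  set α := 1 / (p - 1) with hα
  have hα0 : 0 < α := by positivity
  have hq0 : 0 < q := by positivity
  -- The conjugate exponent of q is p - 1, so Hölder on (0,x) produces exactly the power x^(1/(p-1))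
  -- by which u'' is bounded below.
  have hpq : q.HolderConjugate (p - 1) := by
    rw [Real.holderConjugate_iff]
    refine ⟨by rw [hq, lt_div_iff₀ hp2]; linarith, by rw [hq]; field_simp; ring⟩
  have hac : AbsolutelyContinuousOnInterval U 0 1 := h.absolutelyContinuous_curvature hp' hG
  -- an upper bound by Hölder's inequality
  have hLi : IntegrableOn (fun x => ‖deriv U x‖ ^ q) (Ioo 0 1) := by
    have := hL.integrable_norm_rpow (by simpa using hq0) (by simp)
    rwa [ENNReal.toReal_ofReal hq0.le] at this
  have upper : ∀ x ∈ Ioo (0:ℝ) 1,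
      |U x| ≤ (∫ t in (0:ℝ)..x, ‖deriv U t‖ ^ q) ^ (1 / q) * x ^ α := by
    intro x hx
    have hx' : x ∈ uIcc (0:ℝ) 1 := by
      rw [uIcc_of_le zero_le_one]; exact Ioo_subset_Icc_self hx
    have hUx : U x = ∫ t in (0:ℝ)..x, deriv U t := by
      rw [hac.eq_add_integral_deriv hx', show U 0 = 0 from curvature_zero hp', zero_add]
    have hLx : MemLp (deriv U) (ENNReal.ofReal q) (volume.restrict (Ioo 0 x)) :=
      hL.mono_measure (Measure.restrict_mono (Ioo_subset_Ioo_right hx.2.le) le_rfl)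
    have hö := integral_mul_norm_le_Lp_mul_Lq hpq hLx
      (memLp_const (p := ENNReal.ofReal (p - 1)) (μ := volume.restrict (Ioo 0 x)) (1:ℝ))
    have hone : ∫ _ in Ioo (0:ℝ) x, ‖(1:ℝ)‖ ^ (p - 1) = x := by
      simp [hx.1.le]
    rw [hone, ← hα, integral_Ioo_eq_interval _ hx.1.le, integral_Ioo_eq_interval _ hx.1.le] at hö
    rw [hUx]
    refine le_trans ?_ hö
    have := intervalIntegral.norm_integral_le_integral_norm (f := deriv U) (μ := volume) hx.1.le
    simpa using this
  -- a lower bound from the linear growth of the flux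
  have hp0 : 0 < p := by linarith
  obtain ⟨k, hk, hlow⟩ := h.lower
  obtain ⟨Γ, hΓ⟩ := (isCompact_Icc (a := (0:ℝ)) (b := 1)).exists_bound_of_continuousOn
    (h.continuous_weight hG).continuousOn
  have hgΓ : ∀ x ∈ Icc (0:ℝ) 1, deriv G (v x) ≤ Γ := fun x hx => (le_abs_self _).trans (hΓ x hx)
  have hΓ0 : 0 < Γ := (hG.deriv_pos _).trans_le (hgΓ 0 ⟨le_rfl, zero_le_one⟩)
  set κ := (k / (2 * p)) ^ α / Γ with hκ
  have hκ0 : 0 < κ := div_pos (Real.rpow_pos_of_pos (by positivity) _) hΓ0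
  have lower : ∀ x ∈ Ioo (0:ℝ) (1 / 2), κ * x ^ α ≤ |U x| := by
    intro x hx
    have hxI : x ∈ Icc (0:ℝ) 1 := ⟨hx.1.le, by linarith [hx.2]⟩
    have hWx : k / (2 * p) * x ≤ flux μ c (fun y => deriv G (v y)) x / p := by
      have h1 : k * (x * (1 / 2)) ≤ k * (x * (1 - x)) := by
        have := hx.1.le; have := hx.2; gcongr; linarith
      have h2 := h1.trans (hlow x hxI)
      rw [le_div_iff₀ hp0]
      refine le_trans (le_of_eq ?_) h2
      field_simp
    have hpow : (k / (2 * p)) ^ α * x ^ α ≤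
        (flux μ c (fun y => deriv G (v y)) x / p) ^ α := by
      rw [← Real.mul_rpow (by positivity) hx.1.le]
      exact Real.rpow_le_rpow (mul_nonneg (by positivity) hx.1.le) hWx hα0.le
    have hU' : |U x| = (flux μ c (fun y => deriv G (v y)) x / p) ^ α / deriv G (v x) := by
      rw [hU, curvature, neg_div, abs_neg, abs_of_nonneg]
      exact div_nonneg (Real.rpow_nonneg (div_nonneg (h.flux_nonneg hxI) hp0.le) _)
        (hG.deriv_pos _).le
    rw [hU', hκ, div_mul_eq_mul_div]
    exact div_le_div₀ (Real.rpow_nonneg (div_nonneg (h.flux_nonneg hxI) hp0.le) _) hpow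
      (hG.deriv_pos _) (hgΓ x hxI)
  have hlim : Tendsto (fun x => ∫ t in (0:ℝ)..x, ‖deriv U t‖ ^ q) (𝓝[>] 0) (𝓝 0) := by
    have hc := intervalIntegral.continuousOn_primitive_interval
      (f := fun t => ‖deriv U t‖ ^ q) (μ := volume) (a := 0) (b := 1) (by
        rw [uIcc_of_le zero_le_one, integrableOn_Icc_iff_integrableOn_Ioo]; exact hLi)
    have h0 := hc 0 left_mem_uIcc
    rw [ContinuousWithinAt, intervalIntegral.integral_same] at h0
    refine h0.mono_left ?_
    rw [uIcc_of_le zero_le_one, ← nhdsWithin_Ioo_eq_nhdsGT (zero_lt_one (α := ℝ))]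
    exact nhdsWithin_mono _ Ioo_subset_Icc_self
  have hlim' : Tendsto (fun x => (∫ t in (0:ℝ)..x, ‖deriv U t‖ ^ q) ^ (1 / q)) (𝓝[>] 0) (𝓝 0) := by
    have := hlim.rpow_const (p := 1 / q) (Or.inr (by positivity))
    rwa [Real.zero_rpow (by positivity)] at this
  -- Dividing both bounds by x^α leaves a positive constant below a norm over (0,x), which tends to
  -- 0.
  have hev : ∀ᶠ x in 𝓝[>] (0:ℝ), κ ≤ (∫ t in (0:ℝ)..x, ‖deriv U t‖ ^ q) ^ (1 / q) := by
    filter_upwards [Ioo_mem_nhdsGT (show (0:ℝ) < 1 / 2 by norm_num)] with x hx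
    have h1 := (lower x hx).trans (upper x ⟨hx.1, by linarith [hx.2]⟩)
    exact le_of_mul_le_mul_right h1 (Real.rpow_pos_of_pos hx.1 _)
  have := ge_of_tendsto hlim' hev
  linarith

/-! ### Cone obstacles: failure of C³. -/

/-- The contact set with a cone is its vertex. -/
theorem coincidenceSet_subset_of_isCone (h : CriticalProfile p G ψ u v μ c) (hp : 1 < p)
    (hG : IsAdmissible G) (hψ : IsObstacle ψ) (hu : MemM p ψ u) {θ a b a' b' : ℝ}
    (hθ : θ ∈ Ioo (0:ℝ) 1) (h1 : ∀ x ∈ Icc 0 θ, ψ x = a * x + b)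
    (h2 : ∀ x ∈ Icc θ 1, ψ x = a' * x + b') : coincidenceSet ψ u ⊆ {θ} := by
  have hconc := (h.strictConcaveOn hp hG).2
  -- On a piece where ψ is affine, ψ lies below the chord of u, since it does so at the two ends;
  -- strict concavity puts u strictly above the chord inside.
  have seg : ∀ y z a b : ℝ, y ∈ Icc (0:ℝ) 1 → z ∈ Icc (0:ℝ) 1 →
      (∀ x ∈ Icc y z, ψ x = a * x + b) → ∀ x ∈ Ioo y z, ψ x < u x := by
    intro y z a b hy hz hlin x hx
    have hyz : y < z := hx.1.trans hx.2
    have hd : 0 < z - y := by linarith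
    have hs : (z - x) / (z - y) + (x - y) / (z - y) = 1 := by field_simp; ring
    have key := hconc hy hz hyz.ne (a := (z - x) / (z - y)) (b := (x - y) / (z - y))
      (div_pos (by linarith [hx.2]) hd) (div_pos (by linarith [hx.1]) hd) hs
    have hcomb : ((z - x) / (z - y)) • y + ((x - y) / (z - y)) • z = x := by
      simp only [smul_eq_mul]; field_simp; ring
    rw [hcomb] at key
    refine lt_of_le_of_lt ?_ key
    have k1 := hu.above y hy
    have k2 := hu.above z hz
    rw [hlin y ⟨le_rfl, hyz.le⟩] at k1
    rw [hlin z ⟨hyz.le, le_rfl⟩] at k2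
    have n1 : 0 ≤ (z - x) / (z - y) := div_nonneg (by linarith [hx.2]) hd.le
    have n2 : 0 ≤ (x - y) / (z - y) := div_nonneg (by linarith [hx.1]) hd.le
    have k3 := add_le_add (mul_le_mul_of_nonneg_left k1 n1) (mul_le_mul_of_nonneg_left k2 n2)
    simp only [smul_eq_mul]
    refine le_trans (le_of_eq ?_) k3
    rw [hlin x ⟨hx.1.le, hx.2.le⟩]
    simp only [smul_eq_mul] at hcomb
    calc a * x + b = a * ((z - x) / (z - y) * y + (x - y) / (z - y) * z) +
          ((z - x) / (z - y) + (x - y) / (z - y)) * b := by rw [hcomb, hs, one_mul]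
      _ = _ := by ring
  rintro x ⟨hx, hxu⟩
  by_contra hne
  rcases lt_or_gt_of_ne hne with hlt | hlt
  · rcases hx.1.eq_or_lt with h0 | h0
    · have := hu.navier.left
      have := hψ.left
      rw [← h0] at hxu
      linarith
    · have := seg 0 θ a b ⟨le_rfl, zero_le_one⟩ (Ioo_subset_Icc_self hθ) h1 x ⟨h0, hlt⟩
      linarith
  · rcases hx.2.eq_or_lt with h0 | h0
    · have := hu.navier.right
      have := hψ.right
      rw [h0] at hxu
      linarith
    · have := seg θ 1 a' b' (Ioo_subset_Icc_self hθ) ⟨zero_le_one, le_rfl⟩ h2 x ⟨hlt, h0⟩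
      linarith

/-- μ is concentrated at the vertex, so g times the one-sided derivatives of the flux there are M -
c and -c. If u were C³, the flux, a smooth function of u'' and G'(u') while positive, would be
differentiable at the vertex, forcing M = 0. -/
theorem not_contDiffOn_three_of_isCone (h : CriticalProfile p G ψ u v μ c) (hp : 1 < p)
    (hG : IsAdmissible G) (hψ : IsObstacle ψ) (hu : MemM p ψ u) (hcone : IsCone ψ) :
    ¬ ContDiffOn ℝ 3 u (Ioo 0 1) := by
  intro hC
  have := h.finite
  obtain ⟨θ, hθ, a, b, a', b', h1, h2⟩ := hcone
  have hsub := h.coincidenceSet_subset_of_isCone hp hG hψ hu hθ h1 h2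
  have hp1 : 0 < p - 1 := by linarith
  have hp0 : 0 < p := by linarith
  have hnull : ∀ s : Set ℝ, θ ∉ s → μ s = 0 := fun s hs =>
    measure_mono_null (fun x hx (hx' : x ∈ coincidenceSet ψ u) =>
      hs ((mem_singleton_iff.1 (hsub hx')) ▸ hx)) h.supp
  set M := μ.real univ with hM
  have hl : ∀ y ≤ θ, μ.real (Icc y 1) = M := fun y hy =>
    measureReal_congr (by rw [ae_eq_univ]; exact hnull _ fun hx => hx ⟨hy, hθ.2.le⟩)
  have hr : ∀ y, θ < y → μ.real (Icc y 1) = 0 := fun y hy => by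
    rw [measureReal_def, hnull _ fun hx => not_lt.2 hx.1 hy, ENNReal.toReal_zero]
  set g : ℝ → ℝ := fun x => deriv G (v x) with hg
  have hgc : Continuous g := h.continuous_weight hG
  have hg0 : ∀ x, 0 < g x := fun x => hG.deriv_pos _
  set U := curvature p G v μ c with hU
  -- the flux is differentiable at the vertex
  have hUd : DifferentiableAt ℝ U θ := by
    have hd : ContDiffOn ℝ 2 (deriv u) (Ioo 0 1) :=
      ((contDiffOn_succ_iff_deriv_of_isOpen (n := 2) isOpen_Ioo).1 hC).2.2
    have hdd : ContDiffOn ℝ 1 (deriv (deriv u)) (Ioo 0 1) :=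
      ((contDiffOn_succ_iff_deriv_of_isOpen (n := 1) isOpen_Ioo).1 hd).2.2
    have := (hdd.differentiableOn (by simp)).differentiableAt (isOpen_Ioo.mem_nhds hθ)
    refine this.congr_of_eventuallyEq ?_
    filter_upwards [isOpen_Ioo.mem_nhds hθ] with x hx
    exact (h.deriv_deriv_u hx).symm
  have hgd : DifferentiableAt ℝ g θ :=
    ((hG.contDiff_deriv.differentiable (by simp)) _).comp θ
      (h.hasDerivAt_curvature (Ioo_subset_Icc_self hθ)).differentiableAt
  have hWeq : ∀ x ∈ Ioo (0:ℝ) 1, flux μ c g x = p * (-U x * g x) ^ (p - 1) := by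
    intro x hx
    have e : -U x * g x = (flux μ c g x / p) ^ (1 / (p - 1)) := by
      rw [hU, curvature, neg_div, neg_neg, div_mul_cancel₀ _ (hg0 x).ne']
    rw [e, one_div, Real.rpow_inv_rpow (div_nonneg (h.flux_pos hx).le hp0.le) hp1.ne',
      mul_div_cancel₀ _ hp0.ne']
  have hWd : DifferentiableAt ℝ (flux μ c g) θ := by
    have h3 : DifferentiableAt ℝ (fun x => p * (-U x * g x) ^ (p - 1)) θ := by
      refine ((hUd.neg.mul hgd).rpow_const (Or.inl ?_)).const_mul p
      exact (mul_pos (neg_pos.2 (h.curvature_neg hp hG hθ)) (hg0 θ)).ne'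
    refine h3.congr_of_eventuallyEq ?_
    filter_upwards [isOpen_Ioo.mem_nhds hθ] with x hx
    exact hWeq x hx
  -- its one-sided derivatives differ
  have hprim : ∀ K : ℝ, HasDerivAt (fun x => flux μ c g θ + ∫ y in θ..x, K / g y) (K / g θ) θ :=
    fun K => ((continuous_const.div hgc fun x => (hg0 x).ne').integral_hasStrictDerivAt θ
      θ).hasDerivAt.const_add _
  have hflux : ∀ x, flux μ c g x = flux μ c g θ + ∫ y in θ..x, (μ.real (Icc y 1) - c) / g y :=
    fun x => by rw [← flux_eq_sub hgc hg0]; ring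
  have hleft : HasDerivWithinAt (flux μ c g) ((M - c) / g θ) (Iic θ) θ := by
    refine (hprim (M - c)).hasDerivWithinAt.congr (fun x hx => ?_) (by simp)
    rw [hflux x]
    congr 1
    refine intervalIntegral.integral_congr fun y hy => ?_
    rw [uIcc_of_ge hx] at hy
    simp only [hl y hy.2]
  have hright : HasDerivWithinAt (flux μ c g) ((0 - c) / g θ) (Ici θ) θ := by
    refine (hprim (0 - c)).hasDerivWithinAt.congr (fun x hx => ?_) (by simp)
    rw [hflux x]
    congr 1
    -- The tail at θ itself still contains the atom, so the integrands agree only on the half-open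
    -- interval (θ, x].
    refine intervalIntegral.integral_congr_ae (Eventually.of_forall fun y hy => ?_)
    rw [uIoc_of_le hx] at hy
    simp only [hr y hy.1]
  have d1 := (uniqueDiffWithinAt_Iic θ).eq_deriv _ hWd.hasDerivAt.hasDerivWithinAt hleft
  have d2 := (uniqueDiffWithinAt_Ici θ).eq_deriv _ hWd.hasDerivAt.hasDerivWithinAt hright
  have d3 : (M - c) / g θ = (0 - c) / g θ := d1.symm.trans d2
  rw [div_left_inj' (hg0 θ).ne'] at d3
  linarith [h.c_pos, h.c_lt]

end CriticalProfile

/-! ### A cone obstacle with a critical point. -/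

theorem IsAdmissible.deriv_even {G : ℝ → ℝ} (hG : IsAdmissible G) (s : ℝ) :
    deriv G (-s) = deriv G s := by
  have h1 : (fun s => G (-s)) = fun s => -G s := funext hG.odd
  have h2 := deriv_comp_neg G s
  rw [h1, deriv.fun_neg] at h2
  linarith

/-- A continuous function bounded below by a positive constant has a primitive that is a
`C¹` diffeomorphism of the line. -/
theorem exists_inverse_primitive {f : ℝ → ℝ} (hf : Continuous f) {m : ℝ} (hm : 0 < m)
    (hfm : ∀ x, m ≤ f x) : ∃ T : ℝ → ℝ, StrictMono T ∧
      (∀ x, T (∫ t in (0:ℝ)..x, f t) = x) ∧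
      ∀ x, HasDerivAt T (f (T x))⁻¹ x := by
  set X : ℝ → ℝ := fun x => ∫ t in (0:ℝ)..x, f t with hX
  have hd : ∀ x, HasDerivAt X (f x) x := fun x => (hf.integral_hasStrictDerivAt 0 x).hasDerivAt
  have hmono : StrictMono X :=
    strictMono_of_deriv_pos fun x => by rw [(hd x).deriv]; exact hm.trans_le (hfm x)
  have hc : Continuous X := continuous_iff_continuousAt.2 fun x => (hd x).continuousAt
  have htop : Tendsto X atTop atTop := by
    refine tendsto_atTop_mono' _ ?_ (tendsto_id.const_mul_atTop hm)
    filter_upwards [eventually_ge_atTop 0] with x hx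
    have := mul_sub_le_intervalIntegral hx (hf.intervalIntegrable 0 x) fun y _ => hfm y
    simpa using this
  have hbot : Tendsto X atBot atBot := by
    refine tendsto_atBot_mono' _ ?_ (tendsto_id.const_mul_atBot hm)
    filter_upwards [eventually_le_atBot 0] with x hx
    have := mul_sub_le_intervalIntegral hx (hf.intervalIntegrable x 0) fun y _ => hfm y
    have e : X x = -∫ t in x..0, f t := intervalIntegral.integral_symm _ _
    simp only [id] at this ⊢
    linarith
  set e := hmono.orderIsoOfSurjective X (hc.surjective htop hbot) with he
  have h1 : ∀ x, X (e.symm x) = x := fun x => e.apply_symm_apply x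
  have h2 : ∀ x, e.symm (X x) = x := fun x => e.symm_apply_apply x
  refine ⟨e.symm, e.symm.strictMono, h2, fun x => ?_⟩
  exact HasDerivAt.of_local_left_inverse e.symm.continuous.continuousAt (hd _)
    (hm.trans_le (hfm _)).ne' (Eventually.of_forall h1)

/-- For every admissible `G` there is a `C¹` function on `(0,1)` that is symmetric about `1/2` and
solves the Euler–Lagrange equation away from the vertex `1/2`. -/
theorem exists_symmetric_profile {p : ℝ} (hp : 1 < p) {G : ℝ → ℝ} (hG : IsAdmissible G) :
    ∃ (T V z : ℝ → ℝ) (A B : ℝ), 0 < A ∧ 0 < B ∧ T 0 = 0 ∧ Continuous z ∧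
      (∀ x, HasDerivAt V (z x) x) ∧ (∀ x, V (1 - x) = -V x) ∧
      (∀ x ∈ Ico (0:ℝ) (1 / 2), 0 < V x) ∧ (∀ x ∈ Icc (0:ℝ) (1 / 2), V x ≤ 1) ∧
      (∀ x ∈ Icc (0:ℝ) (1 / 2), HasDerivAt T (1 / (B * deriv G (V x))) x) ∧
      (∀ x ∈ Ioo (0:ℝ) 1,
        -p * deriv G (V x) ^ (p - 1) * (|z x| ^ (p - 2) * z x) = A * T (min x (1 - x))) := by
  have hp1 : 0 < p - 1 := by linarith
  -- Chosen so that (γ - 1)(p - 1) = 1: with slope 1 - r^γ in terms of the parameter r, Euler's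
  -- substitution is then linear in r.
  set γ := p / (p - 1) with hγ
  have hγ1 : 1 ≤ γ := by rw [hγ, le_div_iff₀ hp1]; linarith
  have hγ0 : 0 < γ := by linarith
  have hγp : (γ - 1) * (p - 1) = 1 := by rw [hγ]; field_simp; ring
  -- The slope as a function of r. Truncation at 0 keeps its values in [0,1] for all real r, so G'
  -- composed with it is bounded below by a positive constant.
  set b : ℝ → ℝ := fun r => max 0 (1 - |r| ^ γ) with hb
  have hbc : Continuous b :=
    continuous_const.max (continuous_const.sub (continuous_abs.rpow_const fun _ => Or.inr hγ0.le))
  have hbI : ∀ r, b r ∈ Icc (0:ℝ) 1 := fun r => ⟨le_max_left _ _, max_le zero_le_one (by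
    have := Real.rpow_nonneg (abs_nonneg r) γ
    linarith)⟩
  obtain ⟨r₀, hr₀, hmin⟩ := (isCompact_Icc (a := (0:ℝ)) (b := 1)).exists_isMinOn
    (nonempty_Icc.2 zero_le_one) hG.continuous_deriv.continuousOn
  have hm : 0 < deriv G r₀ := hG.deriv_pos _
  set L := ∫ t in (0:ℝ)..1, deriv G (b t) with hL
  have hgc : Continuous fun r => deriv G (b r) := hG.continuous_deriv.comp hbc
  have hL0 : 0 < L := intervalIntegral.intervalIntegral_pos_of_pos (hgc.intervalIntegrable _ _)
    (fun x => hG.deriv_pos _) one_pos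
  -- Normalised so that r = 1, where the slope vanishes, is reached at x = 1/2.
  set B := 1 / (2 * L) with hB
  have hB0 : 0 < B := by positivity
  obtain ⟨T, hTmono, hTl, hTd⟩ := exists_inverse_primitive
    (f := fun r => B * deriv G (b r)) (continuous_const.mul hgc) (m := B * deriv G r₀)
    (by positivity) (fun x => mul_le_mul_of_nonneg_left (hmin (hbI x)) hB0.le)
  have hTc : Continuous T := continuous_iff_continuousAt.2 fun x => (hTd x).continuousAt
  have hT0 : T 0 = 0 := by
    have := hTl 0
    rwa [intervalIntegral.integral_same] at this
  have hT1 : T (1 / 2) = 1 := by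
    have := hTl 1
    rw [intervalIntegral.integral_const_mul, ← hL, hB] at this
    rwa [show 1 / (2 * L) * L = 1 / 2 by field_simp] at this
  have hTI : ∀ x ∈ Icc (0:ℝ) (1 / 2), T x ∈ Icc (0:ℝ) 1 := fun x hx =>
    ⟨hT0 ▸ hTmono.monotone hx.1, hT1 ▸ hTmono.monotone hx.2⟩
  set s : ℝ → ℝ := fun x => min x (1 - x) with hs
  have hsc : Continuous s := continuous_id.min (continuous_const.sub continuous_id)
  have hs1 : ∀ x, s (1 - x) = s x := fun x => by
    simp only [hs, sub_sub_cancel, min_comm]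
  set z : ℝ → ℝ := fun x => -(γ * T (s x) ^ (γ - 1) * (B * deriv G (b (T (s x))))⁻¹) with hz
  have hzc : Continuous z := by
    have h1 : Continuous fun x => T (s x) := hTc.comp hsc
    refine ((continuous_const.mul (h1.rpow_const fun _ => Or.inr (by linarith))).mul
      (Continuous.inv₀ (continuous_const.mul (hgc.comp h1)) fun x => ?_)).neg
    exact (mul_pos hB0 (hG.deriv_pos _)).ne'
  set V : ℝ → ℝ := fun x => ∫ t in (1 / 2 : ℝ)..x, z t with hV
  have hVd : ∀ x, HasDerivAt V (z x) x := fun x =>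
    (hzc.integral_hasStrictDerivAt _ x).hasDerivAt
  have hVl : ∀ x ∈ Icc (0:ℝ) (1 / 2), V x = 1 - T x ^ γ := by
    intro x hx
    have hF : ∀ y ∈ uIcc (1 / 2 : ℝ) x, HasDerivAt (fun y => 1 - T y ^ γ) (z y) y := by
      intro y hy
      rw [uIcc_of_ge hx.2] at hy
      have hsy : s y = y := min_eq_left (by linarith [hy.2])
      refine (((hTd y).rpow_const (p := γ) (Or.inr hγ1)).const_sub 1).congr_deriv ?_
      simp only [hz, hsy]
      ring
    have := intervalIntegral.integral_eq_sub_of_hasDerivAt hF (hzc.intervalIntegrable _ _)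
    simp only [hV, this, hT1, Real.one_rpow]
    ring
  have hVodd : ∀ x, V (1 - x) = -V x := by
    intro x
    have hzz : ∀ y, z (1 - y) = z y := fun y => by simp only [hz, hs1]
    have := intervalIntegral.integral_comp_sub_left (a := 1 / 2) (b := x) z 1
    simp only [hzz] at this
    simp only [hV, this]
    rw [show (1:ℝ) - 1 / 2 = 1 / 2 by norm_num]
    exact intervalIntegral.integral_symm _ _
  have hbV : ∀ x ∈ Icc (0:ℝ) (1 / 2), b (T x) = V x := by
    intro x hx
    rw [hVl x hx]
    simp only [hb]
    rw [abs_of_nonneg (hTI x hx).1, max_eq_right]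
    have := Real.rpow_le_one (hTI x hx).1 (hTI x hx).2 hγ0.le
    linarith
  have hgV : ∀ x ∈ Ioo (0:ℝ) 1, deriv G (b (T (s x))) = deriv G (V x) := by
    intro x hx
    rcases le_total x (1 / 2) with h | h
    · have : s x = x := min_eq_left (by linarith)
      rw [this, hbV x ⟨hx.1.le, h⟩]
    · have : s x = 1 - x := min_eq_right (by linarith)
      rw [this, hbV (1 - x) ⟨by linarith [hx.2], by linarith⟩, hVodd, hG.deriv_even]
  refine ⟨T, V, z, p * (γ / B) ^ (p - 1), B, ?_, hB0, hT0, hzc, hVd, hVodd, ?_, ?_, ?_, ?_⟩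
  · have := Real.rpow_pos_of_pos (div_pos hγ0 hB0) (p - 1)
    have : 0 < p := by linarith
    positivity
  · intro x hx
    have hx' : x ∈ Icc (0:ℝ) (1 / 2) := Ico_subset_Icc_self hx
    rw [hVl x hx']
    have := Real.rpow_lt_one (hTI x hx').1 (hT1 ▸ hTmono hx.2) hγ0
    linarith
  · intro x hx
    rw [hVl x hx]
    have := Real.rpow_nonneg (hTI x hx).1 γ
    linarith
  · intro x hx
    have := hTd x
    rwa [hbV x hx, ← one_div] at this
  · intro x hx
    have hsx : 0 < s x := lt_min hx.1 (by linarith [hx.2])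
    have hT : 0 < T (s x) := hT0 ▸ hTmono hsx
    have hg : 0 < deriv G (V x) := hG.deriv_pos _
    have hTγ := Real.rpow_pos_of_pos hT (γ - 1)
    have hzx : z x = -(γ / B * T (s x) ^ (γ - 1) / deriv G (V x)) := by
      simp only [hz, hgV x hx]
      field_simp
    have hzneg : z x ≤ 0 := by rw [hzx, neg_nonpos]; positivity
    have h1 : |z x| ^ (p - 2) * z x = -|z x| ^ (p - 1) := by
      rw [← abs_rpow_sub_two_mul_abs hp, abs_of_nonpos hzneg]; ring
    have h2 : deriv G (V x) ^ (p - 1) * |z x| ^ (p - 1) = (γ / B) ^ (p - 1) * T (s x) := by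
      rw [← Real.mul_rpow hg.le (abs_nonneg _), abs_of_nonpos hzneg, hzx, neg_neg,
        mul_div_cancel₀ _ hg.ne', Real.mul_rpow (by positivity) hTγ.le, ← Real.rpow_mul hT.le,
        hγp, Real.rpow_one]
    rw [h1, mul_assoc p, ← h2]
    ring

/-- There is a cone obstacle with a critical point. -/
theorem exists_isCone_isCriticalPoint {p : ℝ} (hp : 1 < p) {G : ℝ → ℝ} (hG : IsAdmissible G) :
    ∃ ψ u : ℝ → ℝ, IsObstacle ψ ∧ IsCone ψ ∧ IsCriticalPoint p G ψ u := by
  obtain ⟨T, V, z, A, B, hA, hB, hT0, hzc, hVd, hVodd, hVpos, hVle, hTd, hW⟩ :=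
    exists_symmetric_profile hp hG
  have hVc : Continuous V := continuous_iff_continuousAt.2 fun x => (hVd x).continuousAt
  have hVabs : ∀ x ∈ Icc (0:ℝ) 1, |V x| ≤ 1 := by
    have half : ∀ x ∈ Icc (0:ℝ) (1 / 2), |V x| ≤ 1 := fun x hx => by
      rw [abs_of_nonneg]
      · exact hVle x hx
      · rcases hx.2.eq_or_lt with h | h
        · have := hVodd x
          rw [h, show (1:ℝ) - 1 / 2 = 1 / 2 by norm_num] at this
          rw [h]; linarith
        · exact (hVpos x ⟨hx.1, h⟩).le
    intro x hx
    rcases le_total x (1 / 2) with h | h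
    · exact half x ⟨hx.1, h⟩
    · rw [← abs_neg, ← hVodd]
      exact half (1 - x) ⟨by linarith [hx.2], by linarith⟩
  set u : ℝ → ℝ := fun x => ∫ t in (0:ℝ)..x, V t with hu
  have hVi : ∀ a b, IntervalIntegrable V volume a b := fun a b => hVc.intervalIntegrable a b
  have hu1 : u 1 = 0 := by
    have := intervalIntegral.integral_comp_sub_left (a := 0) (b := 1) V 1
    simp only [hVodd, sub_self, sub_zero, intervalIntegral.integral_neg] at this
    simp only [hu]
    linarith
  have hVac : AbsolutelyContinuousOnInterval V 0 1 :=
    .of_hasDerivAt (fun x _ => hVd x) hzc.continuousOn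
  have hdV : deriv V = z := funext fun x => (hVd x).deriv
  have huN : MemNavier p u := .of_deriv hVc hVac
    (by rw [hdV]; exact memLp_of_continuous hzc.continuousOn) (fun _ _ => rfl) hu1
  have huhalf : u (1 / 2) ≤ 1 / 2 := by
    have := intervalIntegral_le_mul_sub (K := 1) (by norm_num : (0:ℝ) ≤ 1 / 2) (hVi _ _)
      fun y hy => hVle y (Ioo_subset_Icc_self hy)
    simp only [hu]; linarith
  have huhalf0 : 0 < u (1 / 2) :=
    intervalIntegral.intervalIntegral_pos_of_pos_on (hVi _ _)
      (fun x hx => hVpos x (Ioo_subset_Ico_self hx)) (by norm_num)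
  -- Sides of slope ±2 stay below u because |u'| ≤ 1, and u(1/2) ≤ 1/2 makes the end values u(1/2) -
  -- 1 negative.
  set ψ : ℝ → ℝ := fun x => u (1 / 2) - 2 * |x - 1 / 2| with hψ
  have hψc : Continuous ψ := by fun_prop
  have hcoin : (1 / 2 : ℝ) ∈ coincidenceSet ψ u := by
    refine ⟨⟨by norm_num, by norm_num⟩, ?_⟩
    simp [hψ]
  have habove : ∀ x ∈ Icc (0:ℝ) 1, ψ x ≤ u x := by
    intro x hx
    have h1 : u x - u (1 / 2) = ∫ t in (1 / 2 : ℝ)..x, V t :=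
      intervalIntegral.integral_interval_sub_left (hVi _ _) (hVi _ _)
    have h2 := intervalIntegral.norm_integral_le_of_norm_le_const (f := V) (a := 1 / 2) (b := x)
      (C := 1) fun y hy => hVabs y <| by
        rcases le_total (1 / 2) x with h | h
        · rw [uIoc_of_le h] at hy; exact ⟨by linarith [hy.1], hy.2.trans hx.2⟩
        · rw [uIoc_of_ge h] at hy; exact ⟨hx.1.trans hy.1.le, by linarith [hy.2]⟩
    rw [← h1, Real.norm_eq_abs] at h2
    have h3 := (abs_le.1 h2).1
    have h4 := abs_nonneg (x - 1 / 2)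
    simp only [hψ]
    linarith
  -- The mass 2A/B is the drop of g·W' at 1/2, which equals A/B on the left and -A/B on the right.
  refine ⟨ψ, u, ⟨hψc.continuousOn, ?_, ?_, 1 / 2, ⟨by norm_num, by norm_num⟩, ?_⟩,
    ⟨1 / 2, ⟨by norm_num, by norm_num⟩, 2, u (1 / 2) - 1, -2, u (1 / 2) + 1, ?_, ?_⟩,
    ⟨huN, habove⟩, ENNReal.ofReal (2 * (A / B)) • Measure.dirac (1 / 2), ?_, ?_, ?_⟩
  · simp only [hψ]; norm_num; linarith
  · simp only [hψ]; norm_num [abs_of_pos]; linarith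
  · simpa [hψ] using huhalf0
  · intro x hx
    simp only [hψ]
    rw [abs_of_nonpos (by linarith [hx.2])]; ring
  · intro x hx
    simp only [hψ]
    rw [abs_of_nonneg (by linarith [hx.1])]; ring
  · have : IsFiniteMeasure (ENNReal.ofReal (2 * (A / B)) • Measure.dirac (1 / 2 : ℝ)) :=
      Measure.smul_finite _ ENNReal.ofReal_ne_top
    infer_instance
  · rw [Measure.smul_apply, Measure.dirac_apply, indicator_of_notMem (notMem_compl_iff.2 hcoin), smul_zero]
  intro φ hφ
  obtain ⟨φ₁, hφ₁c, hφ₁ac, -, hφrep⟩ := hφ.exists_deriv hp.le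
  set η : ℝ → ℝ := fun x => deriv G (V x) * φ₁ x with hη
  have hgac : AbsolutelyContinuousOnInterval (fun x => deriv G (V x)) 0 1 :=
    hVac.contDiff_comp (hG.contDiff_deriv.of_le (by simp))
  have hηac : AbsolutelyContinuousOnInterval η 0 1 := hgac.fun_mul hφ₁ac
  have hwu := (hasWeakDeriv_of_eq_primitive hVc (f := u) fun _ _ => rfl).weakDeriv_ae_eq
  have hwφ := (hasWeakDeriv_of_eq_primitive hφ₁c hφrep).weakDeriv_ae_eq
  have hwη := ((HasWeakDeriv.of_absolutelyContinuous_Icc hηac).congr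
    (f' := fun y => deriv G (weakDeriv u y) * weakDeriv φ y) (by
      filter_upwards [hwu, hwφ] with x h1 h2
      rw [h1, h2]) (ae_eq_refl _)).weakDeriv_ae_eq
  have hL : ∫ x in Ioo (0:ℝ) 1, eulerSubst p G u x *
      weakDeriv (fun y => deriv G (weakDeriv u y) * weakDeriv φ y) x =
      ∫ x in (0:ℝ)..1, A * T (min x (1 - x)) * deriv η x := by
    rw [← integral_Ioo_eq_interval _ zero_le_one]
    refine integral_congr_ae ?_
    filter_upwards [hwη, eulerSubst_ae_eq (p := p) (G := G) (u := u) hVc hVac fun _ _ => rfl,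
      ae_restrict_mem measurableSet_Ioo] with x h1 h2 h3
    rw [h1, h2, hdV, hW x h3]
  have hR : ∫ x in Icc (0:ℝ) 1, φ x ∂(ENNReal.ofReal (2 * (A / B)) • Measure.dirac (1 / 2 : ℝ)) =
      2 * (A / B) * φ (1 / 2) := by
    have h1 : (Measure.dirac (1 / 2 : ℝ)).restrict (Icc (0:ℝ) 1) = Measure.dirac (1 / 2 : ℝ) := by
      rw [Measure.restrict_eq_self_of_ae_mem]
      rw [ae_dirac_eq]
      exact ⟨by norm_num, by norm_num⟩
    rw [Measure.restrict_smul, h1, integral_smul_measure, integral_dirac,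
      ENNReal.toReal_ofReal (by positivity), smul_eq_mul]
  have h01 : uIcc (0:ℝ) 1 = Icc 0 1 := uIcc_of_le zero_le_one
  have hl2 : (0:ℝ) ≤ 1 / 2 := by norm_num
  have hr2 : (1 / 2 : ℝ) ≤ 1 := by norm_num
  have hcg : ContinuousOn (fun x => 1 / (B * deriv G (V x))) (uIcc 0 (1 / 2)) := by
    have := hG.continuous_deriv.comp hVc
    exact (continuous_const.div (continuous_const.mul this) fun x =>
      (mul_pos hB (hG.deriv_pos _)).ne').continuousOn
  have hηl : AbsolutelyContinuousOnInterval η 0 (1 / 2) := hηac.mono (by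
    rw [h01, uIcc_of_le hl2]; exact Icc_subset_Icc_right hr2)
  have hηr : AbsolutelyContinuousOnInterval η (1 / 2) 1 := hηac.mono (by
    rw [h01, uIcc_of_le hr2]; exact Icc_subset_Icc_left hl2)
  have hTl : ∀ x ∈ uIcc (0:ℝ) (1 / 2), HasDerivAt (fun x => A * T x)
      (A * (1 / (B * deriv G (V x)))) x := fun x hx =>
    (hTd x (by rwa [uIcc_of_le hl2] at hx)).const_mul A
  have hTr : ∀ x ∈ uIcc (1 / 2 : ℝ) 1, HasDerivAt (fun x => A * T (1 - x))
      (-(A * (1 / (B * deriv G (V x))))) x := by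
    intro x hx
    rw [uIcc_of_le hr2] at hx
    have h1 := hTd (1 - x) ⟨by linarith [hx.2], by linarith [hx.1]⟩
    rw [hVodd, hG.deriv_even] at h1
    have h2 : HasDerivAt (fun x : ℝ => 1 - x) (-1) x := (hasDerivAt_id x).const_sub 1
    refine ((h1.comp x h2).const_mul A).congr_deriv ?_
    ring
  have hTlac : AbsolutelyContinuousOnInterval (fun x => A * T x) 0 (1 / 2) :=
    .of_hasDerivAt hTl (continuousOn_const.mul hcg)
  have hcg' : ContinuousOn (fun x => -(A * (1 / (B * deriv G (V x))))) (uIcc (1 / 2) 1) := by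
    have := hG.continuous_deriv.comp hVc
    exact (continuous_const.mul (continuous_const.div (continuous_const.mul this) fun x =>
      (mul_pos hB (hG.deriv_pos _)).ne')).neg.continuousOn
  have hTrac : AbsolutelyContinuousOnInterval (fun x => A * T (1 - x)) (1 / 2) 1 :=
    .of_hasDerivAt hTr hcg'
  have cl : EqOn (fun x => A * T (min x (1 - x)) * deriv η x) (fun x => A * T x * deriv η x)
      (uIcc 0 (1 / 2)) := by
    intro x hx
    rw [uIcc_of_le hl2] at hx
    simp only [min_eq_left (by linarith [hx.2] : x ≤ 1 - x)]
  have cr : EqOn (fun x => A * T (min x (1 - x)) * deriv η x)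
      (fun x => A * T (1 - x) * deriv η x) (uIcc (1 / 2) 1) := by
    intro x hx
    rw [uIcc_of_le hr2] at hx
    simp only [min_eq_right (by linarith [hx.1] : 1 - x ≤ x)]
  have il := hηl.intervalIntegrable_deriv.continuousOn_mul hTlac.continuousOn
  have ir := hηr.intervalIntegrable_deriv.continuousOn_mul hTrac.continuousOn
  -- The flux has a corner at 1/2, so integration by parts is done on each half. The boundary terms
  -- at 1/2 cancel, those at 0 and 1 vanish since T(0) = 0, and each half contributes (A/B)φ(1/2).
  have hsplit : ∫ x in (0:ℝ)..1, A * T (min x (1 - x)) * deriv η x =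
      (∫ x in (0:ℝ)..(1 / 2), A * T x * deriv η x) +
        ∫ x in (1 / 2 : ℝ)..1, A * T (1 - x) * deriv η x := by
    rw [← intervalIntegral.integral_congr cl, ← intervalIntegral.integral_congr cr,
      intervalIntegral.integral_add_adjacent_intervals]
    · exact il.congr fun x hx => (cl (uIoc_subset_uIcc hx)).symm
    · exact ir.congr fun x hx => (cr (uIoc_subset_uIcc hx)).symm
  have pl := hTlac.integral_mul_deriv_eq_deriv_mul hηl
  have pr := hTrac.integral_mul_deriv_eq_deriv_mul hηr
  have el : ∫ x in (0:ℝ)..(1 / 2), deriv (fun x => A * T x) x * η x = A / B * φ (1 / 2) := by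
    rw [hφrep (1 / 2) ⟨hl2, hr2⟩, ← intervalIntegral.integral_const_mul]
    refine intervalIntegral.integral_congr fun x hx => ?_
    have := hG.deriv_pos (V x)
    simp only [(hTl x hx).deriv, hη]
    field_simp
  have er : ∫ x in (1 / 2 : ℝ)..1, deriv (fun x => A * T (1 - x)) x * η x =
      A / B * φ (1 / 2) := by
    have h1 : φ (1 / 2) = -∫ x in (1 / 2 : ℝ)..1, φ₁ x := by
      have h2 := hφrep 1 ⟨zero_le_one, le_rfl⟩
      rw [hφ.right, ← intervalIntegral.integral_add_adjacent_intervals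
        (hφ₁c.intervalIntegrable 0 (1 / 2)) (hφ₁c.intervalIntegrable _ _),
        ← hφrep (1 / 2) ⟨hl2, hr2⟩] at h2
      linarith
    rw [h1, ← intervalIntegral.integral_neg, ← intervalIntegral.integral_const_mul]
    refine intervalIntegral.integral_congr fun x hx => ?_
    have := hG.deriv_pos (V x)
    simp only [(hTr x hx).deriv, hη]
    field_simp
  rw [hL, hR, hsplit, pl, pr, el, er, sub_self, hT0, show (1:ℝ) - 1 / 2 = 1 / 2 by norm_num]
  ring

end ObstacleProblem

/-! ### The theorem. -/

theorem theorem1p1 (p : ℝ) (hp : 1 < p) (G : ℝ → ℝ) (hG : IsAdmissible G) :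
    (∀ ψ u : ℝ → ℝ, IsObstacle ψ → IsCriticalPoint p G ψ u →
      ContDiffOn ℝ 2 u (Icc 0 1) ∧
      (∀ x ∈ Ioo (0 : ℝ) 1, iteratedDerivWithin 2 u (Icc 0 1) x < 0) ∧
      iteratedDerivWithin 2 u (Icc 0 1) 0 = 0 ∧
      iteratedDerivWithin 2 u (Icc 0 1) 1 = 0 ∧
      ConcaveOn ℝ (Icc 0 1) u ∧
      (p ≤ 2 → MemSobolev 3 ⊤ u ∧ MemBV (weakDeriv (weakDeriv (weakDeriv u)))) ∧
      (2 < p →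
        (∀ q : ℝ, 1 ≤ q → q < (p - 1) / (p - 2) → MemSobolev 3 (ENNReal.ofReal q) u) ∧
        ¬ MemSobolev 3 (ENNReal.ofReal ((p - 1) / (p - 2))) u)) ∧
    (p ≤ 2 →
      (∀ ψ u : ℝ → ℝ, IsObstacle ψ → IsCone ψ → IsCriticalPoint p G ψ u →
        ¬ ContDiffOn ℝ 3 u (Ioo 0 1)) ∧
      ∃ ψ u : ℝ → ℝ, IsObstacle ψ ∧ IsCone ψ ∧ IsCriticalPoint p G ψ u ∧
        ¬ ContDiffOn ℝ 3 u (Ioo 0 1)) := by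
  have cone : ∀ ψ u : ℝ → ℝ, IsObstacle ψ → IsCone ψ → IsCriticalPoint p G ψ u →
      ¬ ContDiffOn ℝ 3 u (Ioo 0 1) := by
    intro ψ u hψ hc hu
    obtain ⟨v, μ, c, h⟩ := hu.exists_profile hp hG hψ
    exact h.not_contDiffOn_three_of_isCone hp hG hψ hu.mem hc
  refine ⟨fun ψ u hψ hu => ?_, fun _ => ⟨cone, ?_⟩⟩
  · obtain ⟨v, μ, c, h⟩ := hu.exists_profile hp hG hψ
    have h0 : (0:ℝ) ∈ Icc (0:ℝ) 1 := ⟨le_rfl, zero_le_one⟩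
    have h1 : (1:ℝ) ∈ Icc (0:ℝ) 1 := ⟨zero_le_one, le_rfl⟩
    refine ⟨h.contDiffOn_two hp hG, fun x hx => ?_, ?_, ?_, (h.strictConcaveOn hp hG).concaveOn,
      fun hp2 => ⟨h.memSobolev_three_top hp hG hp2, h.memBV hp hG hp2⟩,
      fun hp2 => ⟨fun q hq hq' => h.memSobolev_three_of_lt hp hG hp2 hq hq',
        h.not_memSobolev_three hp2 hG⟩⟩
    · rw [h.iteratedDerivWithin_two (Ioo_subset_Icc_self hx)]
      exact h.curvature_neg hp hG hx
    · rw [h.iteratedDerivWithin_two h0, CriticalProfile.curvature_zero hp]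
    · rw [h.iteratedDerivWithin_two h1, h.curvature_one hp]
  · obtain ⟨ψ, u, hψ, hc, hu⟩ := exists_isCone_isCriticalPoint hp hG
    exact ⟨ψ, u, hψ, hc, hu, cone ψ u hψ hc hu⟩
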